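/- Let $\Sigma$ be a closed connected oriented smooth surface, the orientation being given by an area form $\rho$, and let $c\in\mathbb R$ be any constant (for example $c=2\pi(2-2\,\mathrm{genus}(\Sigma))/\mathrm{vol}(\Sigma,\rho)$). For a smooth Riemannian metric $g$ on $\Sigma$ let $J_g$ be the unique complex structure compatible with $g$ and the orientation, let $K_g$ be the Gaussian curvature and $\Delta_g=d^*d$ the positive Laplacian. Let $Q(g)$ be the space of smooth complex quadratic differentials on $(\Sigma,J_g)$, i.e. of smooth fields of symmetric $(J_g,\mathbf i)$-complex bilinear forms $\sigma_x:T_x\Sigma\times T_x\Sigma\to\mathbb C$. For $\sigma\in Q(g)$ write $|\sigma|_g=|\sigma(v,v)|/g(v,v)$ (independent of $v\neq0$) and $\bar\partial_v\sigma=\frac12(\nabla_v\sigma+\mathbf i\nabla_{J_gv}\sigma)$, with $\nabla$ the Levi-Civita connection of $g$. Let $\mathcal P$ be the set of all pairs $(g,\sigma)$ with $g$ a smooth Riemannian metric, $\sigma\in Q(g)$ and $|\sigma|_g<1$ everywhere. The group $\mathrm{Diff}_0(\Sigma)$ of diffeomorphisms smoothly isotopic to the identity acts on pairs by pullback. Define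 $$\mathcal M_d=\Big\{(g,\sigma)\in\mathcal P \,\Big|\, \bar\partial\sigma=0,\ K_g+\tfrac12\Delta_g\log\big(1+\sqrt{1-|\sigma|_g^2}\big)=c\Big\}\Big/\mathrm{Diff}_0(\Sigma),$$ $$\mathcal M=\Big\{(g,\sigma)\in\mathcal P \,\Big|\, \bar\partial\sigma=0,\ K_g-\tfrac c2|\sigma|_g^2=\tfrac c2\Big\}\Big/\mathrm{Diff}_0(\Sigma).$$ Then $$R(g,\sigma)=\Big(\big(1+\sqrt{1-|\sigma|_g^2}\big)\,g,\ \sigma\Big)$$ is a well-defined map $R:\mathcal P\to\mathcal P$; it maps solutions of the equations defining $\mathcal M_d$ to solutions of the equations defining $\mathcal M$, and it induces a well-defined isomorphism $\mathcal M_d\to\mathcal M$, $[g,\sigma]\mapsto[R(g,\sigma)]$. More precisely, the induced map is a bijection and a homeomorphism for the quotients of the $C^\infty$ topology, and it is smooth in both directions: a family in $\mathcal M_d$ parametrized by $\mathbb R^n$ lifts locally to smooth families of solutions if and only if its image in $\mathcal M$ does. -/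

import Mathlib

open Set Bundle
open scoped Manifold ContDiff Topology

noncomputable section

/-- The model plane `ℝ²`. -/
abbrev Plane : Type := EuclideanSpace ℝ (Fin 2)

/-- The standard basis of the plane. -/
def stdVec (i : Fin 2) : Plane := EuclideanSpace.single i 1

/-! ### Linear complex structures and quadratic forms on a plane -/

/-- `J` is the linear complex structure compatible with the inner product `G` and with the
orientation given by the area form `η`. -/
def IsCompatibleStructure {V : Type*} [AddCommGroup V] [Module ℝ V] [TopologicalSpace V]
    [IsTopologicalAddGroup V] [ContinuousConstSMul ℝ V]
    (G η : V →L[ℝ] V →L[ℝ] ℝ) (J : V →L[ℝ] V) : Prop :=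
  (∀ v, J (J v) = -v) ∧ (∀ v w, G (J v) (J w) = G v w) ∧ ∀ v, v ≠ 0 → 0 < η v (J v)

theorem plane_decomp (v : Plane) : v = v 0 • stdVec 0 + v 1 • stdVec 1 := by
  ext i
  fin_cases i <;> simp [stdVec]

theorem plane_bilin (B : Plane →L[ℝ] Plane →L[ℝ] ℝ) (v w : Plane) :
    B v w = v 0 * w 0 * B (stdVec 0) (stdVec 0) + v 0 * w 1 * B (stdVec 0) (stdVec 1)
      + v 1 * w 0 * B (stdVec 1) (stdVec 0) + v 1 * w 1 * B (stdVec 1) (stdVec 1) := by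
  conv_lhs => rw [plane_decomp v, plane_decomp w]
  simp only [map_add, map_smul, add_apply, smul_apply, smul_eq_mul]
  ring

theorem stdVec_ne_zero (i : Fin 2) : stdVec i ≠ 0 := by
  simp [stdVec]

/-- On an oriented inner product plane there is exactly one compatible complex structure. -/
theorem existsUnique_isCompatibleStructure (G η : Plane →L[ℝ] Plane →L[ℝ] ℝ)
    (hsymm : ∀ v w, G v w = G w v) (hpos : ∀ v, v ≠ 0 → 0 < G v v)
    (halt : ∀ v, η v v = 0) (hη : η ≠ 0) :
    ∃! J : Plane →L[ℝ] Plane, IsCompatibleStructure G η J := by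
  obtain ⟨a, ha⟩ : ∃ a, G (stdVec 0) (stdVec 0) = a := ⟨_, rfl⟩
  obtain ⟨b, hb⟩ : ∃ b, G (stdVec 0) (stdVec 1) = b := ⟨_, rfl⟩
  obtain ⟨d, hd⟩ : ∃ d, G (stdVec 1) (stdVec 1) = d := ⟨_, rfl⟩
  obtain ⟨k, hk⟩ : ∃ k, η (stdVec 0) (stdVec 1) = k := ⟨_, rfl⟩
  have hGf : ∀ v w : Plane, G v w
      = a * (v 0 * w 0) + b * (v 0 * w 1 + v 1 * w 0) + d * (v 1 * w 1) := by
    intro v w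
    rw [plane_bilin, hsymm (stdVec 1) (stdVec 0), ha, hb, hd]
    ring
  have hη10 : η (stdVec 1) (stdVec 0) = -k := by
    have h := halt (stdVec 0 + stdVec 1)
    simp only [map_add, add_apply, halt, hk] at h
    linarith
  have hηf : ∀ v w : Plane, η v w = k * (v 0 * w 1 - v 1 * w 0) := by
    intro v w
    rw [plane_bilin, halt, halt, hk, hη10]
    ring
  have hk0 : k ≠ 0 := by
    rintro rfl
    apply hη
    ext v w
    rw [hηf]
    simp
  have hapos : 0 < a := ha ▸ hpos _ (stdVec_ne_zero 0)
  have hD : 0 < a * d - b ^ 2 := by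
    have h := hpos (!₂[-b, a]) (by
      intro h
      have := congrArg (fun v : Plane => v 1) h
      simp at this
      exact hapos.ne' this)
    rw [hGf] at h
    simp at h
    have h2 : a * (a * d - b ^ 2) > 0 := by nlinarith
    exact pos_of_mul_pos_right h2 hapos.le
  obtain ⟨t, ht, hkt⟩ : ∃ t : ℝ, t ^ 2 * (a * d - b ^ 2) = 1 ∧ 0 < k * t := by
    have hs : 0 < √(a * d - b ^ 2) := Real.sqrt_pos.2 hD
    have hs2 := Real.sq_sqrt hD.le
    rcases lt_or_gt_of_ne hk0 with h | h
    · refine ⟨-(√(a * d - b ^ 2))⁻¹, ?_, ?_⟩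
      · rw [neg_sq, inv_pow, hs2, inv_mul_cancel₀ hD.ne']
      · have := inv_pos.2 hs
        nlinarith
    · refine ⟨(√(a * d - b ^ 2))⁻¹, ?_, ?_⟩
      · rw [inv_pow, hs2, inv_mul_cancel₀ hD.ne']
      · positivity
  let J₀ : Plane →ₗ[ℝ] Plane :=
    { toFun := fun v => !₂[t * (-b * v 0 - d * v 1), t * (a * v 0 + b * v 1)]
      map_add' := by
        intro v w
        ext i
        fin_cases i <;> simp <;> ring
      map_smul' := by
        intro r v
        ext i
        fin_cases i <;> simp <;> ring }
  have hJ0 : ∀ v, LinearMap.toContinuousLinearMap J₀ v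
      = !₂[t * (-b * v 0 - d * v 1), t * (a * v 0 + b * v 1)] := fun v => rfl
  refine ⟨LinearMap.toContinuousLinearMap J₀, ⟨?_, ?_, ?_⟩, ?_⟩
  · intro v
    rw [hJ0, hJ0]
    ext i
    fin_cases i
    · simp
      linear_combination (-v 0) * ht
    · simp
      linear_combination (-v 1) * ht
  · intro v w
    rw [hJ0, hJ0, hGf, hGf]
    simp
    linear_combination (a * (v 0 * w 0) + b * (v 0 * w 1 + v 1 * w 0) + d * (v 1 * w 1)) * ht
  · intro v hv
    rw [hJ0, hηf]
    simp
    have h := hpos v hv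
    rw [hGf] at h
    have := mul_pos hkt h
    nlinarith
  · rintro J ⟨h1, h2, h3⟩
    obtain ⟨p, hp⟩ : ∃ p, J (stdVec 0) 0 = p := ⟨_, rfl⟩
    obtain ⟨q, hq⟩ : ∃ q, J (stdVec 0) 1 = q := ⟨_, rfl⟩
    obtain ⟨r, hr⟩ : ∃ r, J (stdVec 1) 0 = r := ⟨_, rfl⟩
    obtain ⟨u, hu⟩ : ∃ u, J (stdVec 1) 1 = u := ⟨_, rfl⟩
    have hJ : ∀ v, J v = !₂[p * v 0 + r * v 1, q * v 0 + u * v 1] := by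
      intro v
      conv_lhs => rw [plane_decomp v]
      ext i
      fin_cases i
      · simp [hp, hr]; ring
      · simp [hq, hu]; ring
    have e1 : p * p + r * q = -1 := by
      have := congrArg (fun v : Plane => v 0) (h1 (stdVec 0))
      simpa [hJ, stdVec] using this
    have e2 : q * p + u * q = 0 := by
      have := congrArg (fun v : Plane => v 1) (h1 (stdVec 0))
      simpa [hJ, stdVec] using this
    have e3 : 0 < k * q := by
      have := h3 (stdVec 0) (stdVec_ne_zero 0)
      rw [hηf, hJ] at this
      simpa [stdVec] using this
    have e4 : a * p + b * q = 0 := by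
      have h := h2 (stdVec 0) (J (stdVec 0))
      rw [h1, map_neg, hsymm, hGf] at h
      rw [hJ] at h
      simp [stdVec] at h
      linarith
    have e5 : a * (p * p) + b * (p * q + q * p) + d * (q * q) = a := by
      have h := h2 (stdVec 0) (stdVec 0)
      rw [hGf, hGf, hJ] at h
      simpa [stdVec] using h
    have hq0 : q ≠ 0 := by
      rintro rfl
      simp at e3
    have e6 : q ^ 2 = (t * a) ^ 2 := by
      have : q ^ 2 * (a * d - b ^ 2) = a ^ 2 := by
        linear_combination a * e5 - (a * p + b * q) * e4
      linear_combination t ^ 2 * this - q ^ 2 * ht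
    have e7 : q = t * a := by
      rcases sq_eq_sq_iff_eq_or_eq_neg.1 e6 with h | h
      · exact h
      · exfalso
        rw [h] at e3
        nlinarith [mul_pos hkt hapos]
    have e8 : p = -t * b := by
      have : a * (p + t * b) = 0 := by rw [e7] at e4; linarith
      rcases mul_eq_zero.1 this with h | h
      · exact absurd h hapos.ne'
      · linarith
    have e9 : u = t * b := by
      have : q * (p + u) = 0 := by linarith
      rcases mul_eq_zero.1 this with h | h
      · exact absurd h hq0
      · linarith
    have e10 : r = -t * d := by
      have : q * (r + t * d) = 0 := by
        rw [e8] at e1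
        rw [e7] at e1 ⊢
        linear_combination e1 + ht
      rcases mul_eq_zero.1 this with h | h
      · exact absurd h hq0
      · linarith
    ext v i
    rw [hJ, hJ0, e7, e8, e9, e10]
    fin_cases i <;> simp <;> ring

/-- For a complex quadratic form `q` on a plane with compatible structure `J`, the quotient
`|q(v,v)| / G(v,v)` does not depend on `v ≠ 0`. -/
theorem norm_quotient_indep (G η : Plane →L[ℝ] Plane →L[ℝ] ℝ) (J : Plane →L[ℝ] Plane)
    (q : Plane →L[ℝ] Plane →L[ℝ] ℂ)
    (hsymm : ∀ v w, G v w = G w v) (hpos : ∀ v, v ≠ 0 → 0 < G v v)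
    (halt : ∀ v, η v v = 0)
    (hJ : IsCompatibleStructure G η J) (hq : ∀ v w, q v w = q w v)
    (hqJ : ∀ v w, q (J v) w = Complex.I * q v w) (v w : Plane) (hv : v ≠ 0) (hw : w ≠ 0) :
    ‖q v v‖ / G v v = ‖q w w‖ / G w w := by
  obtain ⟨h1, h2, h3⟩ := hJ
  have hperp : G v (J v) = 0 := by
    have h := h2 v (J v)
    rw [h1, map_neg, hsymm] at h
    linarith
  obtain ⟨a, b, rfl⟩ : ∃ a b : ℝ, w = a • v + b • J v := by
    have hli : LinearIndependent ℝ ![v, J v] := by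
      rw [LinearIndependent.pair_iff]
      intro s t hst
      have e1 := congrArg (fun z => η v z) hst
      simp only [map_add, map_smul, halt, smul_eq_mul, map_zero, mul_zero, zero_add] at e1
      have ht : t = 0 := by
        rcases mul_eq_zero.1 e1 with h | h
        · exact h
        · exact absurd h (h3 v hv).ne'
      refine ⟨?_, ht⟩
      rw [ht, zero_smul, add_zero] at hst
      exact (smul_eq_zero.1 hst).resolve_right hv
    have hspan := hli.span_eq_top_of_card_eq_finrank (by simp [Plane])
    have hw' : w ∈ Submodule.span ℝ (Set.range ![v, J v]) := hspan ▸ Submodule.mem_top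
    simp only [Matrix.range_cons, Matrix.range_empty, Set.union_empty,
      Set.singleton_union, Submodule.mem_span_pair] at hw'
    obtain ⟨a, b, h⟩ := hw'
    exact ⟨a, b, h.symm⟩
  have hqe : q (a • v + b • J v) (a • v + b • J v) = ((a : ℂ) + b * Complex.I) ^ 2 * q v v := by
    simp only [map_add, map_smul, add_apply, smul_apply,
      hqJ, hq v (J v), Complex.real_smul]
    ring_nf
  have hGe : G (a • v + b • J v) (a • v + b • J v) = (a ^ 2 + b ^ 2) * G v v := by
    simp only [map_add, map_smul, add_apply, smul_apply,
      smul_eq_mul, h2, hsymm (J v) v, hperp]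
    ring
  have hn : ‖((a : ℂ) + b * Complex.I) ^ 2‖ = a ^ 2 + b ^ 2 := by
    rw [norm_pow, Complex.norm_add_mul_I, Real.sq_sqrt (by positivity)]
  have hab : a ^ 2 + b ^ 2 ≠ 0 := by
    intro h
    have := hpos _ hw
    rw [hGe, h, zero_mul] at this
    exact lt_irrefl _ this
  rw [hqe, hGe, norm_mul, hn, mul_div_mul_left _ _ hab]

/-! ### Metrics, area forms and quadratic differentials on a surface -/

section Surface

set_option linter.unusedSectionVars false

variable (M : Type*) [TopologicalSpace M] [ChartedSpace Plane M] [IsManifold (𝓡 2) ∞ M]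

/-- Smooth Riemannian metrics on the surface `M`. -/
abbrev Met : Type _ :=
  ContMDiffRiemannianMetric (𝓡 2) ∞ Plane (fun x : M => TangentSpace (𝓡 2) x)

/-- Fields of bilinear maps `T_xM × T_xM → F`. -/
abbrev BilinField (F : Type*) [NormedAddCommGroup F] [NormedSpace ℝ F] : Type _ :=
  ∀ x : M, TangentSpace (𝓡 2) x →L[ℝ] TangentSpace (𝓡 2) x →L[ℝ] F

variable {M} in
/-- Smoothness of a field of bilinear maps, as a section of the corresponding vector bundle. -/
def BilinField.IsSmooth {F : Type*} [NormedAddCommGroup F] [NormedSpace ℝ F]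
    (T : BilinField M F) : Prop :=
  ContMDiff (𝓡 2) ((𝓡 2).prod 𝓘(ℝ, Plane →L[ℝ] Plane →L[ℝ] F)) ∞
    (fun x : M => TotalSpace.mk' (Plane →L[ℝ] Plane →L[ℝ] F)
      (E := fun x : M => TangentSpace (𝓡 2) x →L[ℝ] TangentSpace (𝓡 2) x →L[ℝ] F) x (T x))

/-- A smooth nowhere vanishing `2`-form; it fixes the orientation of the surface. -/
structure AreaForm where
  form : BilinField M ℝ
  alt : ∀ x v, form x v v = 0
  ne_zero : ∀ x, form x ≠ 0
  smooth : form.IsSmooth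

variable {M}

/-- The unique complex structure `J_g` compatible with the metric and the orientation. -/
def complexStructure (ρ : AreaForm M) (g : Met M) (x : M) :
    TangentSpace (𝓡 2) x →L[ℝ] TangentSpace (𝓡 2) x :=
  (existsUnique_isCompatibleStructure (g.inner x) (ρ.form x) (g.symm x) (g.pos x)
    (ρ.alt x) (ρ.ne_zero x)).choose

theorem complexStructure_spec (ρ : AreaForm M) (g : Met M) (x : M) :
    IsCompatibleStructure (g.inner x) (ρ.form x) (complexStructure ρ g x) :=
  (existsUnique_isCompatibleStructure (g.inner x) (ρ.form x) (g.symm x) (g.pos x)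
    (ρ.alt x) (ρ.ne_zero x)).choose_spec.1

/-- `Q(g)`: smooth sections of the symmetric complex bilinear forms on `(TM, J_g)`. -/
structure QuadDiff (ρ : AreaForm M) (g : Met M) where
  form : BilinField M ℂ
  symm : ∀ x v w, form x v w = form x w v
  complex_linear : ∀ x v w, form x (complexStructure ρ g x v) w = Complex.I * form x v w
  smooth : form.IsSmooth

/-- The pointwise norm `|σ|_g = |σ(v,v)| / g(v,v)`, for any tangent vector `v ≠ 0`;
see `quadNorm_eq`. -/
def quadNorm {ρ : AreaForm M} (g : Met M) (σ : QuadDiff ρ g) (x : M) : ℝ :=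
  ‖σ.form x (stdVec 0 : Plane) (stdVec 0 : Plane)‖ /
    g.inner x (stdVec 0 : Plane) (stdVec 0 : Plane)

theorem quadNorm_eq {ρ : AreaForm M} (g : Met M) (σ : QuadDiff ρ g) (x : M)
    (v : TangentSpace (𝓡 2) x) (hv : v ≠ 0) :
    quadNorm g σ x = ‖σ.form x v v‖ / g.inner x v v :=
  norm_quotient_indep (g.inner x) (ρ.form x) (complexStructure ρ g x) (σ.form x)
    (g.symm x) (g.pos x) (ρ.alt x) (complexStructure_spec ρ g x) (σ.symm x)
    (σ.complex_linear x) (stdVec 0) v (stdVec_ne_zero 0) hv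

/-! ### Local coordinates -/

/-- Partial derivative in the plane. -/
def partialD {F : Type*} [NormedAddCommGroup F] [NormedSpace ℝ F] (i : Fin 2) (u : Plane → F) :
    Plane → F :=
  fun y => fderiv ℝ u y (stdVec i)

/-- Iterated partial derivatives. -/
def iterPartialD {F : Type*} [NormedAddCommGroup F] [NormedSpace ℝ F] (l : List (Fin 2))
    (u : Plane → F) : Plane → F :=
  l.foldr partialD u

/-- The `i`-th coordinate vector field of the chart at `p`, at the point with coordinates `y`. -/
def coordVec (p : M) (i : Fin 2) (y : Plane) :
    TangentSpace (𝓡 2) ((extChartAt (𝓡 2) p).symm y) :=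
  mfderiv 𝓘(ℝ, Plane) (𝓡 2) (extChartAt (𝓡 2) p).symm y (stdVec i)

/-- The components of a field of bilinear maps in the chart at `p`. -/
def tensorComp {F : Type*} [NormedAddCommGroup F] [NormedSpace ℝ F] (T : BilinField M F) (p : M)
    (i j : Fin 2) (y : Plane) : F :=
  T ((extChartAt (𝓡 2) p).symm y) (coordVec p i y) (coordVec p j y)

/-- The coordinates of `p` in the chart at `p`. -/
def coordPt (p : M) : Plane := extChartAt (𝓡 2) p p

/-- The matrix `g_ij` of a metric in the chart at `p`. -/
def gramMatrix (g : Met M) (p : M) (y : Plane) : Matrix (Fin 2) (Fin 2) ℝ :=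
  Matrix.of fun i j => tensorComp g.inner p i j y

/-- Christoffel symbols `Γ^k_ij` of the Levi-Civita connection in the chart at `p`. -/
def christoffel (g : Met M) (p : M) (k i j : Fin 2) (y : Plane) : ℝ :=
  (1 / 2) * ∑ l, (gramMatrix g p y)⁻¹ k l *
    (partialD i (tensorComp g.inner p j l) y + partialD j (tensorComp g.inner p i l) y
      - partialD l (tensorComp g.inner p i j) y)

/-- The `l`-th component of `R(∂₀,∂₁)∂₁`, with `R(X,Y) = [∇_X,∇_Y] - ∇_[X,Y]`. -/
def riemann (g : Met M) (p : M) (l : Fin 2) (y : Plane) : ℝ :=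
  partialD 0 (christoffel g p l 1 1) y - partialD 1 (christoffel g p l 0 1) y
    + ∑ m, (christoffel g p l 0 m y * christoffel g p m 1 1 y
      - christoffel g p l 1 m y * christoffel g p m 0 1 y)

/-- Gaussian curvature `K_g = g(R(∂₀,∂₁)∂₁,∂₀) / det(g_ij)`. -/
def gaussCurvature (g : Met M) (p : M) : ℝ :=
  (∑ l, gramMatrix g p (coordPt p) 0 l * riemann g p l (coordPt p)) / (gramMatrix g p (coordPt p)).det

/-- The positive Laplacian `Δ = d^*d` on functions:
`Δu = -(det g)^{-1/2} ∂_i ((det g)^{1/2} g^{ij} ∂_j u)`. -/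
def laplacian (g : Met M) (u : M → ℝ) (p : M) : ℝ :=
  -(√(gramMatrix g p (coordPt p)).det)⁻¹ * ∑ i, partialD i (fun y =>
    √(gramMatrix g p y).det * ∑ j, (gramMatrix g p y)⁻¹ i j *
      partialD j (fun z => u ((extChartAt (𝓡 2) p).symm z)) y) (coordPt p)

/-- Components `(∇_k σ)_ij` of the Levi-Civita covariant derivative of a field of complex
bilinear maps, at `p` in the chart at `p`. -/
def covDerivComp (g : Met M) (σ : BilinField M ℂ) (p : M) (k i j : Fin 2) : ℂ :=
  partialD k (tensorComp σ p i j) (coordPt p)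
    - ∑ m, ((christoffel g p m k i (coordPt p) : ℂ) * tensorComp σ p m j (coordPt p)
      + (christoffel g p m k j (coordPt p) : ℂ) * tensorComp σ p i m (coordPt p))

/-- The components of a tangent vector at `p` in the chart at `p`. -/
def tangentCoord (p : M) (v : TangentSpace (𝓡 2) p) : Plane :=
  mfderiv (𝓡 2) 𝓘(ℝ, Plane) (extChartAt (𝓡 2) p) p v

/-- The Levi-Civita covariant derivative `(∇_v σ)(w,z)` at `p`. -/
def covDeriv (g : Met M) (σ : BilinField M ℂ) (p : M) (v w z : TangentSpace (𝓡 2) p) : ℂ :=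
  ∑ k, ∑ i, ∑ j, ((tangentCoord p v k * tangentCoord p w i * tangentCoord p z j : ℝ) : ℂ) *
    covDerivComp g σ p k i j

/-- `(∂̄_v σ)(w,z)`, where `∂̄_v σ = (∇_v σ + i ∇_{Jv} σ) / 2`. -/
def dbar {ρ : AreaForm M} (g : Met M) (σ : QuadDiff ρ g) (p : M)
    (v w z : TangentSpace (𝓡 2) p) : ℂ :=
  (1 / 2) * (covDeriv g σ.form p v w z
    + Complex.I * covDeriv g σ.form p (complexStructure ρ g p v) w z)

/-! ### The space of pairs and its smooth structures -/

/-- Pairs `(g,σ)` of a metric and a quadratic differential `σ ∈ Q(g)` with `|σ|_g < 1`. -/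
structure MetricPair (ρ : AreaForm M) where
  metric : Met M
  diff : QuadDiff ρ metric
  norm_lt : ∀ x, quadNorm metric diff x < 1

/-- The `C^∞` topology on pairs: local uniform convergence in charts of all partial derivatives of
the components of `g` and `σ`. -/
instance MetricPair.topology (ρ : AreaForm M) : TopologicalSpace (MetricPair ρ) :=
  ⨅ (p : M) (i : Fin 2) (j : Fin 2) (l : List (Fin 2)),
    TopologicalSpace.induced
      (fun q : MetricPair ρ =>
        UniformOnFun.ofFun {K : Set Plane | IsCompact K ∧ K ⊆ (extChartAt (𝓡 2) p).target}
          (iterPartialD l (tensorComp q.metric.inner p i j))) inferInstance ⊓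
    TopologicalSpace.induced
      (fun q : MetricPair ρ =>
        UniformOnFun.ofFun {K : Set Plane | IsCompact K ∧ K ⊆ (extChartAt (𝓡 2) p).target}
          (iterPartialD l (tensorComp q.diff.form p i j))) inferInstance

/-- A family of pairs `γ(t) = (g_t,σ_t)` is smooth over `U ⊆ ℝⁿ` if the components of `g_t` and
`σ_t` in charts depend smoothly on `t ∈ U` and on the point of the surface jointly. -/
def IsSmoothFamily {ρ : AreaForm M} {n : ℕ} (U : Set (EuclideanSpace ℝ (Fin n)))
    (γ : EuclideanSpace ℝ (Fin n) → MetricPair ρ) : Prop :=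
  ∀ (p : M) (i j : Fin 2),
    ContDiffOn ℝ ∞ (fun z : EuclideanSpace ℝ (Fin n) × Plane =>
      tensorComp (γ z.1).metric.inner p i j z.2) (U ×ˢ (extChartAt (𝓡 2) p).target) ∧
    ContDiffOn ℝ ∞ (fun z : EuclideanSpace ℝ (Fin n) × Plane =>
      tensorComp (γ z.1).diff.form p i j z.2) (U ×ˢ (extChartAt (𝓡 2) p).target)

/-! ### Diffeomorphisms isotopic to the identity and moduli spaces -/

/-- `φ ∈ Diff₀(M)`: there is a smooth isotopy of diffeomorphisms from the identity to `φ`. -/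
def IsIsotopicToId (φ : M ≃ₘ⟮𝓡 2, 𝓡 2⟯ M) : Prop :=
  ∃ F : ℝ → (M ≃ₘ⟮𝓡 2, 𝓡 2⟯ M),
    F 0 = Diffeomorph.refl (𝓡 2) M ∞ ∧ F 1 = φ ∧
    ContMDiff (𝓘(ℝ, ℝ).prod (𝓡 2)) (𝓡 2) ∞ (fun z : ℝ × M => F z.1 z.2) ∧
    ContMDiff (𝓘(ℝ, ℝ).prod (𝓡 2)) (𝓡 2) ∞ (fun z : ℝ × M => (F z.1).symm z.2)

theorem isIsotopicToId_refl : IsIsotopicToId (Diffeomorph.refl (𝓡 2) M ∞) :=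
  ⟨fun _ => Diffeomorph.refl (𝓡 2) M ∞, rfl, rfl, contMDiff_snd, contMDiff_snd⟩

theorem IsIsotopicToId.symm {φ : M ≃ₘ⟮𝓡 2, 𝓡 2⟯ M} (h : IsIsotopicToId φ) :
    IsIsotopicToId φ.symm := by
  obtain ⟨F, h0, h1, h2, h3⟩ := h
  exact ⟨fun t => (F t).symm, by simp [h0], by simp [h1], h3, h2⟩

theorem IsIsotopicToId.trans {φ ψ : M ≃ₘ⟮𝓡 2, 𝓡 2⟯ M} (h : IsIsotopicToId φ)
    (h' : IsIsotopicToId ψ) : IsIsotopicToId (φ.trans ψ) := by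
  obtain ⟨F, h0, h1, h2, h3⟩ := h
  obtain ⟨F', h0', h1', h2', h3'⟩ := h'
  refine ⟨fun t => (F t).trans (F' t), by simp [h0, h0'], by simp [h1, h1'], ?_, ?_⟩
  · exact h2'.comp (contMDiff_fst.prodMk h2)
  · exact h3.comp (contMDiff_fst.prodMk h3')

/-- `q = φ^* q'`. -/
def IsPullback {ρ : AreaForm M} (φ : M ≃ₘ⟮𝓡 2, 𝓡 2⟯ M) (q q' : MetricPair ρ) : Prop :=
  ∀ (x : M) (v w : TangentSpace (𝓡 2) x),
    q.metric.inner x v w = q'.metric.inner (φ x)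
      (mfderiv (𝓡 2) (𝓡 2) φ x v) (mfderiv (𝓡 2) (𝓡 2) φ x w) ∧
    q.diff.form x v w = q'.diff.form (φ x)
      (mfderiv (𝓡 2) (𝓡 2) φ x v) (mfderiv (𝓡 2) (𝓡 2) φ x w)

theorem IsPullback.refl {ρ : AreaForm M} (q : MetricPair ρ) :
    IsPullback (Diffeomorph.refl (𝓡 2) M ∞) q q := by
  intro x v w
  simp only [Diffeomorph.coe_refl, mfderiv_id]
  exact ⟨rfl, rfl⟩

theorem IsPullback.trans {ρ : AreaForm M} {φ ψ : M ≃ₘ⟮𝓡 2, 𝓡 2⟯ M} {q q' q'' : MetricPair ρ}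
    (h : IsPullback φ q q') (h' : IsPullback ψ q' q'') : IsPullback (φ.trans ψ) q q'' := by
  intro x v w
  have hc : mfderiv (𝓡 2) (𝓡 2) (φ.trans ψ) x
      = (mfderiv (𝓡 2) (𝓡 2) ψ (φ x)).comp (mfderiv (𝓡 2) (𝓡 2) φ x) := by
    rw [Diffeomorph.coe_trans]
    exact mfderiv_comp x (ψ.mdifferentiable (by simp) _) (φ.mdifferentiable (by simp) _)
  rw [hc, (h x v w).1, (h x v w).2, (h' (φ x) _ _).1, (h' (φ x) _ _).2]
  exact ⟨rfl, rfl⟩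

theorem IsPullback.symm {ρ : AreaForm M} {φ : M ≃ₘ⟮𝓡 2, 𝓡 2⟯ M} {q q' : MetricPair ρ}
    (h : IsPullback φ q q') : IsPullback φ.symm q' q := by
  intro x v w
  have hc : (mfderiv (𝓡 2) (𝓡 2) φ (φ.symm x)).comp (mfderiv (𝓡 2) (𝓡 2) φ.symm x)
      = ContinuousLinearMap.id ℝ (TangentSpace (𝓡 2) x) := by
    rw [← mfderiv_comp x (φ.mdifferentiable (by simp) _) (φ.symm.mdifferentiable (by simp) _)]
    have : (φ ∘ φ.symm : M → M) = id := by
      funext y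
      simp
    rw [this]
    exact mfderiv_id
  have hv : ∀ v : TangentSpace (𝓡 2) x,
      (mfderiv (𝓡 2) (𝓡 2) φ (φ.symm x) (mfderiv (𝓡 2) (𝓡 2) φ.symm x v) : Plane) = v :=
    fun v => DFunLike.congr_fun hc v
  have hx : φ (φ.symm x) = x := φ.apply_symm_apply x
  have key : ∀ (F : Type) [NormedAddCommGroup F] [NormedSpace ℝ F] (T : BilinField M F) (y : M)
      (_ : y = x) (a b : Plane), (T y : Plane →L[ℝ] Plane →L[ℝ] F) a b
        = (T x : Plane →L[ℝ] Plane →L[ℝ] F) a b := by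
    rintro F _ _ T y rfl a b
    rfl
  rw [(h _ _ _).1, (h _ _ _).2]
  constructor
  · refine Eq.trans ?_ (key ℝ q'.metric.inner _ hx _ _).symm
    rw [hv, hv]
  · refine Eq.trans ?_ (key ℂ q'.diff.form _ hx _ _).symm
    rw [hv, hv]

/-- Pairs in the same `Diff₀(M)`-orbit. -/
def orbitSetoid (ρ : AreaForm M) : Setoid (MetricPair ρ) where
  r q q' := ∃ φ : M ≃ₘ⟮𝓡 2, 𝓡 2⟯ M, IsIsotopicToId φ ∧ IsPullback φ q q'
  iseqv :=
    { refl := fun q => ⟨_, isIsotopicToId_refl, IsPullback.refl q⟩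
      symm := fun ⟨φ, h, h'⟩ => ⟨φ.symm, h.symm, h'.symm⟩
      trans := fun ⟨φ, h, h'⟩ ⟨ψ, k, k'⟩ => ⟨φ.trans ψ, h.trans k, h'.trans k'⟩ }

/-- The quotient `S / Diff₀(M)` of a set of pairs, with the quotient of the `C^∞` topology. -/
abbrev ModuliSpace {ρ : AreaForm M} (S : Set (MetricPair ρ)) : Type _ :=
  Quotient ((orbitSetoid ρ).comap (Subtype.val : S → MetricPair ρ))

/-- The class `[g,σ]`. -/
abbrev ModuliSpace.mk {ρ : AreaForm M} {S : Set (MetricPair ρ)} (q : S) : ModuliSpace S :=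
  Quotient.mk _ q

/-- Smooth families `ℝⁿ → S / Diff₀(M)` are those which lift locally to smooth families in `S`
(the quotient diffeology). -/
def IsSmoothModuliFamily {ρ : AreaForm M} {S : Set (MetricPair ρ)} {n : ℕ}
    (γ : EuclideanSpace ℝ (Fin n) → ModuliSpace S) : Prop :=
  ∀ t, ∃ U : Set (EuclideanSpace ℝ (Fin n)), IsOpen U ∧ t ∈ U ∧
    ∃ γ' : EuclideanSpace ℝ (Fin n) → S,
      IsSmoothFamily U (fun s => (γ' s : MetricPair ρ)) ∧ ∀ s ∈ U, γ s = ModuliSpace.mk (γ' s)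

/-- The conformal factor `1 + √(1 - |σ|_g²)`. -/
def conformalFactor {ρ : AreaForm M} (q : MetricPair ρ) (x : M) : ℝ :=
  1 + √(1 - quadNorm q.metric q.diff x ^ 2)

/-- Pairs with `|σ| < 1`, `∂̄σ = 0` and `K_g + ½ Δ log(1 + √(1 - |σ|²)) = c`. -/
def solutionsD (ρ : AreaForm M) (c : ℝ) : Set (MetricPair ρ) :=
  {q | (∀ x v w z, dbar q.metric q.diff x v w z = 0) ∧
    ∀ x, gaussCurvature q.metric x
      + (1 / 2) * laplacian q.metric (fun y => Real.log (conformalFactor q y)) x = c}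

/-- Pairs with `|σ| < 1`, `∂̄σ = 0` and `K_g - (c/2) |σ|² = c/2`. -/
def solutions (ρ : AreaForm M) (c : ℝ) : Set (MetricPair ρ) :=
  {q | (∀ x v w z, dbar q.metric q.diff x v w z = 0) ∧
    ∀ x, gaussCurvature q.metric x - c / 2 * quadNorm q.metric q.diff x ^ 2 = c / 2}

end Surface

end

/-!
A conformal change `g ↦ a(|σ|²) g` of the metric, for a fixed function `a` of one variable, keeps
the complex structure `J_g` and hence the space of quadratic differentials, and divides the norm
`r = |σ|_g` by `a(r²)` (`ConformalProfile.rescale`). The map `R` is the case `a(t) = 1 + √(1 - t)`.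
If `s = |σ|_g` and `r = s / (1 + √(1 - s²))`, then `(1 + r²) / 2 = 1 / (1 + √(1 - s²))`, so the
profile `a(t) = (1 + t) / 2` gives a two-sided inverse of `R` on all pairs (`backward_forward`,
`forward_backward`).

Two facts about conformal metrics show that `R` exchanges the two systems of equations
(`forward_mem_solutions_iff`). First, `∂̄σ` does not depend on the metric in the conformal class:
the Christoffel symbols change by terms in `d log f`, and their contributions to `∂̄σ` cancel because
the complex bilinear forms on a complex line satisfy an exchange identity (`dbar_conformal`). Second,
`f K_{fg} = K_g + ½ Δ_g log f` (`gaussCurvature_conformal`), so with `f = 1 + √(1 - |σ|_g²)` the first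
equation says `K_h = c / f` for `h = f g`, and `c / f = c (1 + |σ|_h²) / 2` is the second equation.
The curvature formula is a comparison of 2-jets of the metric coefficients in a chart.

The pointwise norm is invariant under pullback, so rescaling commutes with diffeomorphisms
(`IsPullback.rescale`). In a chart the coefficients of the rescaled metric are smooth functions of
those of `g` and `σ`; hence rescaling is continuous for the `C^∞` topology
(`ConformalProfile.continuous_rescale`, by induction on the order of differentiation) and preserves
smooth families (`IsSmoothFamily.rescale`). Applied to `R` and to its inverse, this gives the
homeomorphism of moduli spaces and both directions of the statement on smooth families.
-/

noncomputable section

/-! ### Tensors in charts -/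

section Charts

set_option linter.unusedSectionVars false

variable {M : Type*} [TopologicalSpace M] [ChartedSpace Plane M] [IsManifold (𝓡 2) ∞ M]

theorem coordPt_mem_target (p : M) : coordPt p ∈ (extChartAt (𝓡 2) p).target :=
  mem_extChartAt_target p

theorem target_mem_nhds_coordPt (p : M) : (extChartAt (𝓡 2) p).target ∈ 𝓝 (coordPt p) :=
  extChartAt_target_mem_nhds p

theorem symm_coordPt (p : M) : (extChartAt (𝓡 2) p).symm (coordPt p) = p :=
  extChartAt_to_inv p

/-- The coordinate vector fields are smooth sections of the tangent bundle over the target of the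
chart. -/
theorem contMDiffOn_coordVec (p : M) (i : Fin 2) :
    ContMDiffOn 𝓘(ℝ, Plane) (𝓡 2).tangent ∞
      (fun y : Plane => TotalSpace.mk' Plane (E := fun x : M => TangentSpace (𝓡 2) x)
        ((extChartAt (𝓡 2) p).symm y) (coordVec p i y)) (extChartAt (𝓡 2) p).target := by
  have ho : IsOpen (extChartAt (𝓡 2) p).target := isOpen_extChartAt_target p
  have h1 := (contMDiffOn_extChartAt_symm (I := 𝓡 2) (n := ∞) p).contMDiffOn_tangentMapWithin
    (m := ∞) (by norm_num) ho.uniqueMDiffOn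
  have h2 := (contMDiff_vectorSpace_iff_contDiff (𝕜 := ℝ) (E := Plane) (n := ∞)
    (V := fun _ => stdVec i)).2 contDiff_const
  refine (h1.comp h2.contMDiffOn (s := (extChartAt (𝓡 2) p).target) fun y hy => hy).congr ?_
  intro y hy
  simp only [Function.comp, tangentMapWithin, coordVec, mfderivWithin_of_mem_nhds (ho.mem_nhds hy)]

theorem tensorComp_contDiffOn {F : Type*} [NormedAddCommGroup F] [NormedSpace ℝ F]
    {T : BilinField M F} (hT : T.IsSmooth) (p : M) (i j : Fin 2) :
    ContDiffOn ℝ ∞ (tensorComp T p i j) (extChartAt (𝓡 2) p).target := by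
  rw [← contMDiffOn_iff_contDiffOn]
  have h0 := ContMDiff.comp_contMDiffOn hT (contMDiffOn_extChartAt_symm (I := 𝓡 2) (n := ∞) p)
  intro y hy
  have : ContMDiffWithinAt 𝓘(ℝ, Plane) ((𝓡 2).prod 𝓘(ℝ, F)) ∞
      (fun y : Plane => TotalSpace.mk' F (E := Bundle.Trivial M F)
        ((extChartAt (𝓡 2) p).symm y) (tensorComp T p i j y)) (extChartAt (𝓡 2) p).target y := by
    apply ContMDiffWithinAt.clm_bundle_apply₂ (F₁ := Plane) (F₂ := Plane)
      (h0 y hy) (contMDiffOn_coordVec p i y hy) (contMDiffOn_coordVec p j y hy)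
  exact (contMDiffWithinAt_totalSpace.1 this).2

/-- The tangent space at `p` is the model plane by way of the chart at `p`, so the coordinate vectors
of that chart at `p` itself are the standard ones. -/
theorem coordVec_coordPt (p : M) (i : Fin 2) : (coordVec p i (coordPt p) : Plane) = stdVec i := by
  have h := mfderivWithin_range_extChartAt_symm (I := 𝓡 2) (x := p)
  rw [ModelWithCorners.Boundaryless.range_eq_univ, mfderivWithin_univ] at h
  exact DFunLike.congr_fun h (stdVec i)

theorem tangentCoord_eq (p : M) (v : TangentSpace (𝓡 2) p) : tangentCoord p v = v :=
  DFunLike.congr_fun (mfderiv_extChartAt_self (I := 𝓡 2) (x := p)) v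

theorem coordVec_ne_zero (p : M) (i : Fin 2) {y : Plane} (hy : y ∈ (extChartAt (𝓡 2) p).target) :
    coordVec p i y ≠ 0 := by
  have h := isInvertible_mfderivWithin_extChartAt_symm (I := 𝓡 2) hy
  rw [ModelWithCorners.Boundaryless.range_eq_univ, mfderivWithin_univ] at h
  intro h0
  exact stdVec_ne_zero i (h.injective (h0.trans (map_zero _).symm))

theorem tensorComp_coordPt {F : Type*} [NormedAddCommGroup F] [NormedSpace ℝ F]
    (T : BilinField M F) (p : M) (i j : Fin 2) :
    tensorComp T p i j (coordPt p) = T p (stdVec i : Plane) (stdVec j : Plane) := by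
  -- The base point `symm (coordPt p)` is equal to `p` only propositionally.
  have key : ∀ (y : M) (_ : y = p) (a b : Plane), (T y : Plane →L[ℝ] Plane →L[ℝ] F) a b
        = (T p : Plane →L[ℝ] Plane →L[ℝ] F) a b := by
    rintro y rfl a b
    rfl
  have h := key _ (symm_coordPt p) (coordVec p i (coordPt p)) (coordVec p j (coordPt p))
  refine Eq.trans h ?_
  rw [coordVec_coordPt, coordVec_coordPt]

end Charts

/-! ### Conformal rescaling of pairs -/

/-- The data of a conformal change `g ↦ a(|σ|²) g`: a function `a` which is smooth on `(-∞, 1)` and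
satisfies `r < a(r²)` for `0 ≤ r < 1`. The inequality says both that `a` is positive on `[0, 1)`
and that the new norm `r / a(r²)` of `σ` is again less than one. -/
structure ConformalProfile where
  toFun : ℝ → ℝ
  contDiffOn : ContDiffOn ℝ ∞ toFun (Iio 1)
  lt : ∀ r, 0 ≤ r → r < 1 → r < toFun (r ^ 2)

theorem ConformalProfile.pos (a : ConformalProfile) {r : ℝ} (h0 : 0 ≤ r) (h1 : r < 1) :
    0 < a.toFun (r ^ 2) := h0.trans_lt (a.lt r h0 h1)

section Rescale

set_option linter.unusedSectionVars false

variable {M : Type*} [TopologicalSpace M] [ChartedSpace Plane M] [IsManifold (𝓡 2) ∞ M]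
  {ρ : AreaForm M}

theorem Met.isSmooth (g : Met M) : BilinField.IsSmooth (M := M) g.inner := g.contMDiff

theorem quadNorm_nonneg (g : Met M) (σ : QuadDiff ρ g) (x : M) : 0 ≤ quadNorm g σ x :=
  div_nonneg (norm_nonneg _) (g.pos x _ (stdVec_ne_zero 0)).le

/-- The square of `|σ|_g` in the chart at `p`. -/
def quadNormSqComp (q : MetricPair ρ) (p : M) (y : Plane) : ℝ :=
  ((tensorComp q.diff.form p 0 0 y).re ^ 2 + (tensorComp q.diff.form p 0 0 y).im ^ 2) /
    tensorComp q.metric.inner p 0 0 y ^ 2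

theorem tensorComp_inner_pos (g : Met M) (p : M) (i : Fin 2) {y : Plane}
    (hy : y ∈ (extChartAt (𝓡 2) p).target) : 0 < tensorComp g.inner p i i y :=
  g.pos _ _ (coordVec_ne_zero p i hy)

/-- `quadNorm` is evaluated on a fixed vector of the model plane, which is not a continuous vector
field on `M`; evaluating on a coordinate vector field instead exhibits `|σ|²` as a smooth
function. -/
theorem quadNorm_sq_eq (q : MetricPair ρ) (p : M) {y : Plane}
    (hy : y ∈ (extChartAt (𝓡 2) p).target) :
    quadNorm q.metric q.diff ((extChartAt (𝓡 2) p).symm y) ^ 2 = quadNormSqComp q p y := by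
  rw [quadNorm_eq _ _ _ _ (coordVec_ne_zero p 0 hy), div_pow, Complex.sq_norm,
    Complex.normSq_apply, quadNormSqComp]
  simp only [tensorComp, sq]

theorem quadNormSqComp_lt_one (q : MetricPair ρ) (p : M) {y : Plane}
    (hy : y ∈ (extChartAt (𝓡 2) p).target) : quadNormSqComp q p y < 1 := by
  rw [← quadNorm_sq_eq q p hy]
  exact pow_lt_one₀ (quadNorm_nonneg _ _ _) (q.norm_lt _) two_ne_zero

theorem contDiffOn_quadNormSqComp (q : MetricPair ρ) (p : M) :
    ContDiffOn ℝ ∞ (quadNormSqComp q p) (extChartAt (𝓡 2) p).target := by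
  have h1 := tensorComp_contDiffOn q.diff.smooth p 0 0
  have h2 := tensorComp_contDiffOn q.metric.isSmooth p 0 0
  refine ContDiffOn.div (((Complex.reCLM.contDiff.comp_contDiffOn h1).pow 2).add
    ((Complex.imCLM.contDiff.comp_contDiffOn h1).pow 2)) (h2.pow 2) ?_
  intro y hy
  exact pow_ne_zero _ (tensorComp_inner_pos q.metric p 0 hy).ne'

/-- The conformal factor `a(|σ|_g²)`. -/
def ConformalProfile.factor (a : ConformalProfile) (q : MetricPair ρ) (x : M) : ℝ :=
  a.toFun (quadNorm q.metric q.diff x ^ 2)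

theorem ConformalProfile.factor_pos (a : ConformalProfile) (q : MetricPair ρ) (x : M) :
    0 < a.factor q x := a.pos (quadNorm_nonneg _ _ _) (q.norm_lt x)

theorem ConformalProfile.factor_symm (a : ConformalProfile) (q : MetricPair ρ) (p : M) {y : Plane}
    (hy : y ∈ (extChartAt (𝓡 2) p).target) :
    a.factor q ((extChartAt (𝓡 2) p).symm y) = a.toFun (quadNormSqComp q p y) := by
  rw [factor, quadNorm_sq_eq q p hy]

theorem ConformalProfile.contDiffOn_factor (a : ConformalProfile) (q : MetricPair ρ) (p : M) :
    ContDiffOn ℝ ∞ (fun y => a.factor q ((extChartAt (𝓡 2) p).symm y))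
      (extChartAt (𝓡 2) p).target :=
  (a.contDiffOn.comp (contDiffOn_quadNormSqComp q p)
    fun _ hy => quadNormSqComp_lt_one q p hy).congr fun _ hy => a.factor_symm q p hy

theorem ConformalProfile.contMDiff_factor (a : ConformalProfile) (q : MetricPair ρ) :
    ContMDiff (𝓡 2) 𝓘(ℝ, ℝ) ∞ (a.factor q) := by
  intro p
  have h1 : ContMDiffAt 𝓘(ℝ, Plane) 𝓘(ℝ, ℝ) ∞
      (fun y => a.factor q ((extChartAt (𝓡 2) p).symm y)) (extChartAt (𝓡 2) p p) :=
    ((a.contDiffOn_factor q p).contDiffAt (target_mem_nhds_coordPt p)).contMDiffAt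
  refine (h1.comp p contMDiffAt_extChartAt).congr_of_eventuallyEq ?_
  filter_upwards [extChartAt_source_mem_nhds (I := 𝓡 2) p] with x hx
  simp only [Function.comp, (extChartAt (𝓡 2) p).left_inv hx]

set_option synthInstance.maxHeartbeats 200000 in
/-- The conformal metric `f g`. -/
def Met.conformal (g : Met M) (f : M → ℝ) (hf : ContMDiff (𝓡 2) 𝓘(ℝ, ℝ) ∞ f)
    (hpos : ∀ x, 0 < f x) : Met M where
  inner x := f x • g.inner x
  symm x v w := by
    change f x * g.inner x v w = f x * g.inner x w v
    rw [g.symm]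
  pos x v hv := mul_pos (hpos x) (g.pos x v hv)
  isVonNBounded x := by
    let L : TangentSpace (𝓡 2) x →L[ℝ] TangentSpace (𝓡 2) x :=
      (√(f x))⁻¹ • ContinuousLinearMap.id ℝ _
    -- The unit ball of `f g` is the unit ball of `g` scaled by `f^{-1/2}`.
    refine ((g.isVonNBounded x).image L).subset ?_
    intro v hv
    have hs : √(f x) ≠ 0 := (Real.sqrt_pos.2 (hpos x)).ne'
    refine ⟨√(f x) • v, ?_, ?_⟩
    · have hv' : f x * g.inner x v v < 1 := hv
      change g.inner x (√(f x) • v) (√(f x) • v) < 1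
      simp only [map_smul, smul_apply, smul_eq_mul]
      rwa [← mul_assoc, Real.mul_self_sqrt (hpos x).le]
    · change (√(f x))⁻¹ • √(f x) • v = v
      rw [smul_smul, inv_mul_cancel₀ hs, one_smul]
  contMDiff := ContMDiff.smul_section (F := Plane →L[ℝ] Plane →L[ℝ] ℝ)
    (V := fun x : M => TangentSpace (𝓡 2) x →L[ℝ] TangentSpace (𝓡 2) x →L[ℝ] ℝ) (f := f)
    (s := g.inner) hf g.contMDiff

/-- Conformal metrics have the same complex structure. -/
theorem complexStructure_conformal (g : Met M) {f : M → ℝ} (hf : ContMDiff (𝓡 2) 𝓘(ℝ, ℝ) ∞ f)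
    (hpos : ∀ x, 0 < f x) (x : M) :
    complexStructure ρ (g.conformal f hf hpos) x = complexStructure ρ g x := by
  obtain ⟨h1, h2, h3⟩ := complexStructure_spec ρ g x
  refine ((existsUnique_isCompatibleStructure _ (ρ.form x)
    ((g.conformal f hf hpos).symm x) ((g.conformal f hf hpos).pos x) (ρ.alt x) (ρ.ne_zero x)).unique
    (complexStructure_spec ρ (g.conformal f hf hpos) x) ⟨h1, ?_, h3⟩)
  intro v w
  exact congrArg (f x * ·) (h2 v w)

/-- The pair `(a(|σ|_g²) g, σ)`. -/
def ConformalProfile.rescale (a : ConformalProfile) (q : MetricPair ρ) : MetricPair ρ where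
  metric := q.metric.conformal (a.factor q) (a.contMDiff_factor q) (a.factor_pos q)
  diff :=
    { form := q.diff.form
      symm := q.diff.symm
      complex_linear := fun x v w => by
        rw [complexStructure_conformal]
        exact q.diff.complex_linear x v w
      smooth := q.diff.smooth }
  norm_lt x := by
    have h : quadNorm q.metric q.diff x / a.factor q x < 1 :=
      (div_lt_one (a.factor_pos q x)).2 (a.lt _ (quadNorm_nonneg q.metric q.diff x) (q.norm_lt x))
    refine lt_of_eq_of_lt ?_ h
    exact div_mul_eq_div_div_swap ..

theorem ConformalProfile.quadNorm_rescale (a : ConformalProfile) (q : MetricPair ρ) (x : M) :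
    quadNorm (a.rescale q).metric (a.rescale q).diff x
      = quadNorm q.metric q.diff x / a.factor q x := by
  exact div_mul_eq_div_div_swap ..

theorem ConformalProfile.tensorComp_rescale (a : ConformalProfile) (q : MetricPair ρ) (p : M)
    (i j : Fin 2) (y : Plane) :
    tensorComp (a.rescale q).metric.inner p i j y
      = a.factor q ((extChartAt (𝓡 2) p).symm y) * tensorComp q.metric.inner p i j y := rfl

/-- The pointwise norm is invariant under pullback by arbitrary diffeomorphisms, because it may be
computed on any nonzero tangent vector. -/
theorem IsPullback.quadNorm_eq {φ : M ≃ₘ⟮𝓡 2, 𝓡 2⟯ M} {q q' : MetricPair ρ}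
    (h : IsPullback φ q q') (x : M) :
    quadNorm q.metric q.diff x = quadNorm q'.metric q'.diff (φ x) := by
  obtain ⟨v, hv⟩ : ∃ v : TangentSpace (𝓡 2) x, v ≠ 0 := ⟨(stdVec 0 : Plane), stdVec_ne_zero 0⟩
  have hw : mfderiv (𝓡 2) (𝓡 2) φ x v ≠ 0 := by
    intro h0
    have h1 := q.metric.pos x _ hv
    rw [(h x _ _).1, h0, map_zero] at h1
    exact lt_irrefl _ h1
  rw [_root_.quadNorm_eq _ _ _ _ hv, _root_.quadNorm_eq _ _ _ _ hw, (h x _ _).1, (h x _ _).2]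

theorem IsPullback.rescale {φ : M ≃ₘ⟮𝓡 2, 𝓡 2⟯ M} {q q' : MetricPair ρ}
    (h : IsPullback φ q q') (a : ConformalProfile) :
    IsPullback φ (a.rescale q) (a.rescale q') := by
  intro x v w
  have hf : a.factor q x = a.factor q' (φ x) := by
    rw [ConformalProfile.factor, ConformalProfile.factor, h.quadNorm_eq]
  exact ⟨congrArg₂ (· * ·) hf (h x v w).1, (h x v w).2⟩

theorem MetricPair.ext_form {q q' : MetricPair ρ}
    (h1 : ∀ x v w, q.metric.inner x v w = q'.metric.inner x v w)
    (h2 : ∀ x v w, q.diff.form x v w = q'.diff.form x v w) : q = q' := by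
  obtain ⟨⟨i, hi1, hi2, hi3, hi4⟩, ⟨s, hs1, hs2, hs3⟩, hq⟩ := q
  obtain ⟨⟨i', hi1', hi2', hi3', hi4'⟩, ⟨s', hs1', hs2', hs3'⟩, hq'⟩ := q'
  obtain rfl : i = i' := by
    funext x
    ext v w
    exact h1 x v w
  obtain rfl : s = s' := by
    funext x
    ext v w
    exact h2 x v w
  rfl

end Rescale

/-! ### Partial derivatives and continuous families -/

section PartialDerivatives

variable {F G : Type*} [NormedAddCommGroup F] [NormedSpace ℝ F] [NormedAddCommGroup G]
  [NormedSpace ℝ G] {O : Set Plane}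

theorem partialD_contDiffOn (hO : IsOpen O) {u : Plane → F} (hu : ContDiffOn ℝ ∞ u O) (i : Fin 2) :
    ContDiffOn ℝ ∞ (partialD i u) O :=
  (hu.fderiv_of_isOpen hO (by norm_num)).clm_apply contDiffOn_const

theorem partialD_congr (hO : IsOpen O) {u v : Plane → F} (h : EqOn u v O) (i : Fin 2) :
    EqOn (partialD i u) (partialD i v) O := fun y hy => by
  simp only [partialD, (h.eventuallyEq_of_mem (hO.mem_nhds hy)).fderiv_eq]

theorem iterPartialD_congr (hO : IsOpen O) {u v : Plane → F} (h : EqOn u v O) (l : List (Fin 2)) :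
    EqOn (iterPartialD l u) (iterPartialD l v) O := by
  induction l with
  | nil => exact h
  | cons i l ih => exact partialD_congr hO ih i

theorem iterPartialD_contDiffOn (hO : IsOpen O) {u : Plane → F} (hu : ContDiffOn ℝ ∞ u O)
    (l : List (Fin 2)) : ContDiffOn ℝ ∞ (iterPartialD l u) O := by
  induction l with
  | nil => exact hu
  | cons i l ih => exact partialD_contDiffOn hO ih i

theorem iterPartialD_concat (l : List (Fin 2)) (i : Fin 2) (u : Plane → F) :
    iterPartialD (l ++ [i]) u = iterPartialD l (partialD i u) := by
  simp [iterPartialD, List.foldr_append]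

theorem differentiableAt_of_contDiffOn (hO : IsOpen O) {u : Plane → F} (hu : ContDiffOn ℝ ∞ u O)
    {y : Plane} (hy : y ∈ O) : DifferentiableAt ℝ u y :=
  (hu.contDiffAt (hO.mem_nhds hy)).differentiableAt (by simp)

theorem partialD_add {u v : Plane → F} {y : Plane} (hu : DifferentiableAt ℝ u y)
    (hv : DifferentiableAt ℝ v y) (i : Fin 2) :
    partialD i (fun z => u z + v z) y = partialD i u y + partialD i v y := by
  simp only [partialD, fderiv_fun_add hu hv, add_apply]

theorem partialD_mul {u v : Plane → ℝ} {y : Plane} (hu : DifferentiableAt ℝ u y)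
    (hv : DifferentiableAt ℝ v y) (i : Fin 2) :
    partialD i (fun z => u z * v z) y = partialD i u y * v y + u y * partialD i v y := by
  simp only [partialD, fderiv_fun_mul hu hv, add_apply, smul_apply,
    smul_eq_mul]
  ring

theorem partialD_comp {a : ℝ → ℝ} {u : Plane → ℝ} {y : Plane} (ha : DifferentiableAt ℝ a (u y))
    (hu : DifferentiableAt ℝ u y) (i : Fin 2) :
    partialD i (fun z => a (u z)) y = deriv a (u y) * partialD i u y := by
  have := (ha.hasDerivAt.comp_hasFDerivAt y hu.hasFDerivAt).fderiv
  simp only [partialD]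
  change fderiv ℝ (a ∘ u) y _ = _
  rw [this]
  simp

theorem partialD_clm (L : F →L[ℝ] G) {u : Plane → F} {y : Plane} (hu : DifferentiableAt ℝ u y)
    (i : Fin 2) : partialD i (fun z => L (u z)) y = L (partialD i u y) := by
  simp only [partialD]
  change fderiv ℝ (L ∘ u) y _ = _
  rw [fderiv_comp _ L.differentiableAt hu, L.fderiv]
  rfl

end PartialDerivatives

section ContinuousFamilies

variable {F G : Type*} [NormedAddCommGroup F] [NormedSpace ℝ F] [NormedAddCommGroup G]
  [NormedSpace ℝ G] {Q : Type*} [TopologicalSpace Q] {O : Set Plane} {n : ℕ}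

/-- A family `u q` of smooth functions on an open subset `O` of the plane whose partial derivatives
of order at most `n` are jointly continuous in the parameter `q` and the point of `O`. -/
structure IsCkFamily (O : Set Plane) (n : ℕ) (u : Q → Plane → F) : Prop where
  smooth : ∀ q, ContDiffOn ℝ ∞ (u q) O
  cont : ∀ l : List (Fin 2), l.length ≤ n →
    ContinuousOn (fun z : Q × Plane => iterPartialD l (u z.1) z.2) (univ ×ˢ O)

theorem IsCkFamily.continuousOn {u : Q → Plane → F} (h : IsCkFamily O n u) :
    ContinuousOn (fun z : Q × Plane => u z.1 z.2) (univ ×ˢ O) := h.cont [] (Nat.zero_le _)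

theorem IsCkFamily.congr (hO : IsOpen O) {u v : Q → Plane → F} (h : IsCkFamily O n u)
    (huv : ∀ q, EqOn (v q) (u q) O) : IsCkFamily O n v where
  smooth q := (h.smooth q).congr (huv q)
  cont l hl := (h.cont l hl).congr fun z hz => iterPartialD_congr hO (huv z.1) l hz.2

theorem isCkFamily_zero {u : Q → Plane → F} (hs : ∀ q, ContDiffOn ℝ ∞ (u q) O)
    (hc : ContinuousOn (fun z : Q × Plane => u z.1 z.2) (univ ×ˢ O)) : IsCkFamily O 0 u where
  smooth := hs
  cont l hl := by
    obtain rfl : l = [] := List.length_eq_zero_iff.1 (Nat.le_zero.1 hl)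
    exact hc

theorem isCkFamily_succ {u : Q → Plane → F} (hs : ∀ q, ContDiffOn ℝ ∞ (u q) O)
    (hc : ContinuousOn (fun z : Q × Plane => u z.1 z.2) (univ ×ˢ O))
    (hd : ∀ i, IsCkFamily O n (fun q => partialD i (u q))) : IsCkFamily O (n + 1) u where
  smooth := hs
  cont l hl := by
    rcases List.eq_nil_or_concat l with rfl | ⟨l, i, rfl⟩
    · exact hc
    · rw [List.concat_eq_append] at hl ⊢
      simp only [iterPartialD_concat]
      exact (hd i).cont l (by simpa using hl)

theorem IsCkFamily.partialD (hO : IsOpen O) {u : Q → Plane → F} (h : IsCkFamily O (n + 1) u)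
    (i : Fin 2) : IsCkFamily O n (fun q => partialD i (u q)) where
  smooth q := partialD_contDiffOn hO (h.smooth q) i
  cont l hl := by
    simp only [← iterPartialD_concat]
    exact h.cont _ (by simpa using hl)

theorem IsCkFamily.of_succ {u : Q → Plane → F} (h : IsCkFamily O (n + 1) u) :
    IsCkFamily O n u := ⟨h.smooth, fun l hl => h.cont l (hl.trans n.le_succ)⟩

theorem IsCkFamily.add (hO : IsOpen O) {u v : Q → Plane → F} (hu : IsCkFamily O n u)
    (hv : IsCkFamily O n v) : IsCkFamily O n (fun q y => u q y + v q y) := by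
  induction n generalizing u v with
  | zero =>
    exact isCkFamily_zero (fun q => (hu.smooth q).add (hv.smooth q))
      (hu.continuousOn.add hv.continuousOn)
  | succ n ih =>
    refine isCkFamily_succ (fun q => (hu.smooth q).add (hv.smooth q))
      (hu.continuousOn.add hv.continuousOn) fun i => ?_
    exact (ih (hu.partialD hO i) (hv.partialD hO i)).congr hO fun q y hy =>
      partialD_add (differentiableAt_of_contDiffOn hO (hu.smooth q) hy)
        (differentiableAt_of_contDiffOn hO (hv.smooth q) hy) i

theorem IsCkFamily.mul (hO : IsOpen O) {u v : Q → Plane → ℝ} (hu : IsCkFamily O n u)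
    (hv : IsCkFamily O n v) : IsCkFamily O n (fun q y => u q y * v q y) := by
  induction n generalizing u v with
  | zero =>
    exact isCkFamily_zero (fun q => (hu.smooth q).mul (hv.smooth q))
      (hu.continuousOn.mul hv.continuousOn)
  | succ n ih =>
    refine isCkFamily_succ (fun q => (hu.smooth q).mul (hv.smooth q))
      (hu.continuousOn.mul hv.continuousOn) fun i => ?_
    exact ((ih (hu.partialD hO i) hv.of_succ).add hO (ih hu.of_succ (hv.partialD hO i))).congr hO
      fun q y hy => partialD_mul (differentiableAt_of_contDiffOn hO (hu.smooth q) hy)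
        (differentiableAt_of_contDiffOn hO (hv.smooth q) hy) i

theorem IsCkFamily.comp (hO : IsOpen O) {s : Set ℝ} (hs : IsOpen s) {a : ℝ → ℝ}
    (ha : ContDiffOn ℝ ∞ a s) {u : Q → Plane → ℝ} (hu : IsCkFamily O n u)
    (hus : ∀ q, ∀ y ∈ O, u q y ∈ s) : IsCkFamily O n (fun q y => a (u q y)) := by
  have h1 : ∀ {b : ℝ → ℝ}, ContDiffOn ℝ ∞ b s → ∀ q, ContDiffOn ℝ ∞ (fun y => b (u q y)) O :=
    fun hb q => hb.comp (hu.smooth q) (hus q)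
  have h2 : ∀ {b : ℝ → ℝ}, ContDiffOn ℝ ∞ b s →
      ContinuousOn (fun z : Q × Plane => b (u z.1 z.2)) (univ ×ˢ O) :=
    fun hb => hb.continuousOn.comp hu.continuousOn fun z hz => hus z.1 z.2 hz.2
  induction n generalizing a with
  | zero => exact isCkFamily_zero (h1 ha) (h2 ha)
  | succ n ih =>
    refine isCkFamily_succ (h1 ha) (h2 ha) fun i => ?_
    have hd := ih (ha.deriv_of_isOpen hs (m := ∞) (by norm_num)) hu.of_succ
    exact (hd.mul hO (hu.partialD hO i)).congr hO fun q y hy =>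
      partialD_comp ((ha.contDiffAt (hs.mem_nhds (hus q y hy))).differentiableAt (by simp))
        (differentiableAt_of_contDiffOn hO (hu.smooth q) hy) i

theorem IsCkFamily.clm_comp (hO : IsOpen O) (L : F →L[ℝ] G) {u : Q → Plane → F}
    (hu : IsCkFamily O n u) : IsCkFamily O n (fun q y => L (u q y)) := by
  have h1 := fun q => L.contDiff.comp_contDiffOn (hu.smooth q)
  induction n generalizing u with
  | zero => exact isCkFamily_zero h1 (L.continuous.comp_continuousOn hu.continuousOn)
  | succ n ih =>
    refine isCkFamily_succ h1 (L.continuous.comp_continuousOn hu.continuousOn) fun i => ?_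
    exact (ih (hu.partialD hO i)
      fun q => L.contDiff.comp_contDiffOn ((hu.partialD hO i).smooth q)).congr hO fun q y hy =>
      partialD_clm L (differentiableAt_of_contDiffOn hO (hu.smooth q) hy) i

/-- Continuity for uniform convergence on the compact subsets of `O` is joint continuity on `O`,
since `O` is locally compact. -/
theorem continuous_ofFun_iff {F : Type*} [NormedAddCommGroup F] (hO : IsOpen O)
    {u : Q → Plane → F}
    (hu : ∀ q, ContinuousOn (u q) O) :
    Continuous (fun q => UniformOnFun.ofFun {K : Set Plane | IsCompact K ∧ K ⊆ O} (u q)) ↔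
      ContinuousOn (fun z : Q × Plane => u z.1 z.2) (univ ×ˢ O) := by
  rw [continuous_iff_continuousAt]
  simp only [ContinuousAt, UniformOnFun.tendsto_iff_tendstoUniformlyOn]
  constructor
  · rintro h ⟨q, y⟩ ⟨-, hy⟩
    obtain ⟨K, hK, hKO, hKc⟩ := local_compact_nhds (hO.mem_nhds hy)
    have hun := h q K ⟨hKc, hKO⟩
    refine tendsto_comp_of_locally_uniform_limit_within (F := fun z : Q × Plane => u z.1)
      (g := Prod.snd) (hu q y hy) ?_ ?_
    · rw [nhdsWithin_prod_eq]
      exact Filter.tendsto_snd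
    · intro V hV
      refine ⟨K, mem_nhdsWithin_of_mem_nhds hK, ?_⟩
      have h1 : Filter.Tendsto Prod.fst (𝓝[univ ×ˢ O] (q, y)) (𝓝 q) :=
        continuous_fst.continuousAt.mono_left nhdsWithin_le_nhds
      exact h1.eventually (hun V hV)
  · rintro h q K ⟨hKc, hKO⟩ V hV
    obtain ⟨v, hv, hv'⟩ := hKc.mem_uniformity_of_prod (f := u) (s := univ) (q := q)
      (h.mono (prod_mono_right hKO)) (mem_univ q) (symm_le_uniformity hV)
    rw [nhdsWithin_univ] at hv
    filter_upwards [hv] with p hp y hy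
    exact hv' p hp y hy

end ContinuousFamilies

/-! ### Continuity and smoothness of rescaling -/

section Rescale

set_option linter.unusedSectionVars false

variable {M : Type*} [TopologicalSpace M] [ChartedSpace Plane M] [IsManifold (𝓡 2) ∞ M]
  {ρ : AreaForm M}

theorem isCkFamily_metric (p : M) (i j : Fin 2) (n : ℕ) :
    IsCkFamily (extChartAt (𝓡 2) p).target n
      (fun q : MetricPair ρ => tensorComp q.metric.inner p i j) where
  smooth q := tensorComp_contDiffOn q.metric.isSmooth p i j
  cont l _ := by
    have hO : IsOpen (extChartAt (𝓡 2) p).target := isOpen_extChartAt_target p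
    refine (continuous_ofFun_iff hO fun q : MetricPair ρ => (iterPartialD_contDiffOn hO
      (tensorComp_contDiffOn q.metric.isSmooth p i j) l).continuousOn).1 ?_
    exact continuous_iInf_dom (i := p) <| continuous_iInf_dom (i := i) <|
      continuous_iInf_dom (i := j) <| continuous_iInf_dom (i := l) <|
      continuous_iff_le_induced.2 inf_le_left

theorem isCkFamily_diff (p : M) (i j : Fin 2) (n : ℕ) :
    IsCkFamily (extChartAt (𝓡 2) p).target n
      (fun q : MetricPair ρ => tensorComp q.diff.form p i j) where
  smooth q := tensorComp_contDiffOn q.diff.smooth p i j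
  cont l _ := by
    have hO : IsOpen (extChartAt (𝓡 2) p).target := isOpen_extChartAt_target p
    refine (continuous_ofFun_iff hO fun q : MetricPair ρ => (iterPartialD_contDiffOn hO
      (tensorComp_contDiffOn q.diff.smooth p i j) l).continuousOn).1 ?_
    exact continuous_iInf_dom (i := p) <| continuous_iInf_dom (i := i) <|
      continuous_iInf_dom (i := j) <| continuous_iInf_dom (i := l) <|
      continuous_iff_le_induced.2 inf_le_right

theorem isCkFamily_quadNormSqComp (p : M) (n : ℕ) :
    IsCkFamily (extChartAt (𝓡 2) p).target n (fun q : MetricPair ρ => quadNormSqComp q p) := by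
  have hO : IsOpen (extChartAt (𝓡 2) p).target := isOpen_extChartAt_target p
  have hσ := isCkFamily_diff (ρ := ρ) p 0 0 n
  have hre := hσ.clm_comp hO Complex.reCLM
  have him := hσ.clm_comp hO Complex.imCLM
  have hg := (isCkFamily_metric (ρ := ρ) p 0 0 n).comp hO (s := {0}ᶜ) isOpen_compl_singleton
    (a := fun x => x⁻¹) (fun x hx => (contDiffAt_inv ℝ hx).contDiffWithinAt)
    fun q y hy => (tensorComp_inner_pos q.metric p 0 hy).ne'
  refine (((hre.mul hO hre).add hO (him.mul hO him)).mul hO (hg.mul hO hg)).congr hO ?_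
  intro q y _
  simp only [quadNormSqComp, Complex.reCLM_apply, Complex.imCLM_apply, div_eq_mul_inv, sq, mul_inv]

theorem ConformalProfile.continuous_rescale (a : ConformalProfile) :
    Continuous (a.rescale : MetricPair ρ → MetricPair ρ) := by
  refine continuous_iInf_rng.2 fun p => continuous_iInf_rng.2 fun i => continuous_iInf_rng.2
    fun j => continuous_iInf_rng.2 fun l => continuous_inf_rng.2
      ⟨continuous_induced_rng.2 ?_, continuous_induced_rng.2 ?_⟩
  · have hO : IsOpen (extChartAt (𝓡 2) p).target := isOpen_extChartAt_target p
    have h : IsCkFamily (extChartAt (𝓡 2) p).target l.length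
        (fun q : MetricPair ρ => tensorComp (a.rescale q).metric.inner p i j) := by
      refine (((isCkFamily_quadNormSqComp p l.length).comp hO isOpen_Iio a.contDiffOn
        fun q y hy => quadNormSqComp_lt_one q p hy).mul hO
          (isCkFamily_metric p i j l.length)).congr hO ?_
      intro q y hy
      simp only [a.tensorComp_rescale, a.factor_symm q p hy]
    exact (continuous_ofFun_iff hO fun q =>
      (iterPartialD_contDiffOn hO (h.smooth q) l).continuousOn).2 (h.cont l le_rfl)
  · have hO : IsOpen (extChartAt (𝓡 2) p).target := isOpen_extChartAt_target p
    exact (continuous_ofFun_iff hO fun q : MetricPair ρ => (iterPartialD_contDiffOn hO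
      (tensorComp_contDiffOn q.diff.smooth p i j) l).continuousOn).2
        ((isCkFamily_diff p i j l.length).cont l le_rfl)

theorem IsSmoothFamily.rescale {n : ℕ} {U : Set (EuclideanSpace ℝ (Fin n))}
    {γ : EuclideanSpace ℝ (Fin n) → MetricPair ρ} (h : IsSmoothFamily U γ)
    (a : ConformalProfile) : IsSmoothFamily U (fun t => a.rescale (γ t)) := by
  intro p i j
  refine ⟨?_, (h p i j).2⟩
  have hσ := (h p 0 0).2
  have hg := (h p 0 0).1
  have hn : ContDiffOn ℝ ∞ (fun z : EuclideanSpace ℝ (Fin n) × Plane =>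
      quadNormSqComp (γ z.1) p z.2) (U ×ˢ (extChartAt (𝓡 2) p).target) :=
    ContDiffOn.div (((Complex.reCLM.contDiff.comp_contDiffOn hσ).pow 2).add
      ((Complex.imCLM.contDiff.comp_contDiffOn hσ).pow 2)) (hg.pow 2)
      fun z hz => pow_ne_zero _ (tensorComp_inner_pos _ p 0 hz.2).ne'
  refine ((a.contDiffOn.comp hn fun z hz => quadNormSqComp_lt_one _ p hz.2).mul (h p i j).1).congr ?_
  intro z hz
  simp only [a.tensorComp_rescale, a.factor_symm _ p hz.2, Function.comp]

end Rescale

/-! ### Curvature in coordinates -/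

section PartialDerivatives

variable {O : Set Plane} {u v : Plane → ℝ} {y : Plane}

theorem partialD_sub (hu : DifferentiableAt ℝ u y) (hv : DifferentiableAt ℝ v y) (i : Fin 2) :
    partialD i (fun z => u z - v z) y = partialD i u y - partialD i v y := by
  simp only [partialD, fderiv_fun_sub hu hv, sub_apply]

theorem partialD_const_mul (hu : DifferentiableAt ℝ u y) (c : ℝ) (i : Fin 2) :
    partialD i (fun z => c * u z) y = c * partialD i u y := by
  simp only [partialD, fderiv_const_mul hu, smul_apply, smul_eq_mul]

theorem partialD_inv (hu : DifferentiableAt ℝ u y) (h0 : u y ≠ 0) (i : Fin 2) :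
    partialD i (fun z => (u z)⁻¹) y = -partialD i u y / u y ^ 2 := by
  rw [partialD_comp (differentiableAt_inv h0) hu, deriv_inv]
  field_simp

theorem partialD_div (hu : DifferentiableAt ℝ u y) (hv : DifferentiableAt ℝ v y) (h0 : v y ≠ 0)
    (i : Fin 2) : partialD i (fun z => u z / v z) y
      = (partialD i u y * v y - u y * partialD i v y) / v y ^ 2 := by
  simp only [div_eq_mul_inv]
  rw [partialD_mul hu (hv.fun_inv h0), partialD_inv hv h0]
  field_simp
  ring

theorem partialD_sqrt (hu : DifferentiableAt ℝ u y) (h0 : u y ≠ 0) (i : Fin 2) :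
    partialD i (fun z => √(u z)) y = partialD i u y / (2 * √(u y)) := by
  rw [partialD_comp (Real.hasDerivAt_sqrt h0).differentiableAt hu, (Real.hasDerivAt_sqrt h0).deriv]
  ring

theorem partialD_log (hu : DifferentiableAt ℝ u y) (h0 : u y ≠ 0) (i : Fin 2) :
    partialD i (fun z => Real.log (u z)) y = partialD i u y / u y := by
  rw [partialD_comp (Real.differentiableAt_log h0) hu, Real.deriv_log]
  ring

theorem partialD_comm (hu : ContDiffAt ℝ 2 u y) (i j : Fin 2) :
    partialD i (partialD j u) y = partialD j (partialD i u) y := by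
  have h1 : ∀ k l, partialD k (partialD l u) y
      = fderiv ℝ (fderiv ℝ u) y (stdVec k) (stdVec l) := by
    intro k l
    have hd : DifferentiableAt ℝ (fderiv ℝ u) y :=
      (hu.fderiv_right (m := 1) (by norm_num)).differentiableAt (by norm_num)
    change fderiv ℝ (fun z => fderiv ℝ u z (stdVec l)) y (stdVec k) = _
    rw [fderiv_clm_apply hd (differentiableAt_const _)]
    simp
  rw [h1, h1]
  exact (hu.isSymmSndFDerivAt (by simp)) _ _

end PartialDerivatives

section Curvature

set_option linter.unusedSectionVars false

variable {M : Type*} [TopologicalSpace M] [ChartedSpace Plane M] [IsManifold (𝓡 2) ∞ M]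

/-- The determinant `g₀₀ g₁₁ - g₀₁²` in the chart at `p`. -/
def gramDet (g : Met M) (p : M) (y : Plane) : ℝ :=
  tensorComp g.inner p 0 0 y * tensorComp g.inner p 1 1 y - tensorComp g.inner p 0 1 y ^ 2

theorem tensorComp_inner_symm (g : Met M) (p : M) :
    tensorComp g.inner p 1 0 = tensorComp g.inner p 0 1 :=
  funext fun _ => g.symm _ _ _

theorem gramMatrix_det (g : Met M) (p : M) (y : Plane) :
    (gramMatrix g p y).det = gramDet g p y := by
  simp [Matrix.det_fin_two, gramMatrix, gramDet, tensorComp_inner_symm]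
  ring

/-- Positivity of `g` on the vector `-g₀₁ ∂₀ + g₀₀ ∂₁`, whose square length is `g₀₀ det(g)`. -/
theorem gramDet_pos (g : Met M) (p : M) {y : Plane} (hy : y ∈ (extChartAt (𝓡 2) p).target) :
    0 < gramDet g p y := by
  have h := isInvertible_mfderivWithin_extChartAt_symm (I := 𝓡 2) hy
  rw [ModelWithCorners.Boundaryless.range_eq_univ, mfderivWithin_univ] at h
  have hE := tensorComp_inner_pos g p 0 hy
  set E := tensorComp g.inner p 0 0 y with hE'
  set F := tensorComp g.inner p 0 1 y with hF'
  have hw : (-F) • coordVec p 0 y + E • coordVec p 1 y ≠ 0 := by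
    have hw' : (-F) • stdVec 0 + E • stdVec 1 ≠ 0 := by
      intro h0
      have := congrArg (fun v : Plane => v 1) h0
      simp [stdVec] at this
      exact hE.ne' this
    intro h0
    apply hw'
    refine h.injective (Eq.trans ?_ (map_zero _).symm)
    refine Eq.trans ?_ h0
    refine (map_add _ _ _).trans (congrArg₂ (· + ·) (map_smul _ _ _) (map_smul _ _ _))
  have hp := g.pos _ _ hw
  have he : g.inner ((extChartAt (𝓡 2) p).symm y) ((-F) • coordVec p 0 y + E • coordVec p 1 y)
      ((-F) • coordVec p 0 y + E • coordVec p 1 y) = E * gramDet g p y := by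
    simp only [map_add, map_smul, add_apply, smul_apply, smul_eq_mul]
    change -F * (-F * tensorComp g.inner p 0 0 y + E * tensorComp g.inner p 1 0 y)
      + E * (-F * tensorComp g.inner p 0 1 y + E * tensorComp g.inner p 1 1 y) = _
    rw [tensorComp_inner_symm, gramDet, ← hE', ← hF']
    ring
  rw [he] at hp
  exact pos_of_mul_pos_right hp hE.le

theorem gramMatrix_inv (g : Met M) (p : M) (y : Plane) :
    (gramMatrix g p y)⁻¹ 0 0 = tensorComp g.inner p 1 1 y / gramDet g p y ∧
    (gramMatrix g p y)⁻¹ 0 1 = -tensorComp g.inner p 0 1 y / gramDet g p y ∧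
    (gramMatrix g p y)⁻¹ 1 0 = -tensorComp g.inner p 0 1 y / gramDet g p y ∧
    (gramMatrix g p y)⁻¹ 1 1 = tensorComp g.inner p 0 0 y / gramDet g p y := by
  rw [Matrix.inv_def, gramMatrix_det, Ring.inverse_eq_inv', Matrix.adjugate_fin_two]
  simp [gramMatrix, tensorComp_inner_symm, div_eq_inv_mul]

theorem contDiffOn_gramDet (g : Met M) (p : M) :
    ContDiffOn ℝ ∞ (gramDet g p) (extChartAt (𝓡 2) p).target :=
  ((tensorComp_contDiffOn g.isSmooth p 0 0).mul (tensorComp_contDiffOn g.isSmooth p 1 1)).sub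
    ((tensorComp_contDiffOn g.isSmooth p 0 1).pow 2)

theorem contDiffOn_christoffel (g : Met M) (p : M) (k i j : Fin 2) :
    ContDiffOn ℝ ∞ (christoffel g p k i j) (extChartAt (𝓡 2) p).target := by
  have hO : IsOpen (extChartAt (𝓡 2) p).target := isOpen_extChartAt_target p
  have hg := fun i j => tensorComp_contDiffOn g.isSmooth p i j
  have hd := contDiffOn_gramDet g p
  have hne : ∀ y ∈ (extChartAt (𝓡 2) p).target, gramDet g p y ≠ 0 :=
    fun y hy => (gramDet_pos g p hy).ne'
  have hinv : ∀ k l, ContDiffOn ℝ ∞ (fun y => (gramMatrix g p y)⁻¹ k l)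
      (extChartAt (𝓡 2) p).target := by
    intro k l
    fin_cases k <;> fin_cases l
    · exact ((hg 1 1).div hd hne).congr fun y _ => (gramMatrix_inv g p y).1
    · exact ((hg 0 1).neg.div hd hne).congr fun y _ => (gramMatrix_inv g p y).2.1
    · exact ((hg 0 1).neg.div hd hne).congr fun y _ => (gramMatrix_inv g p y).2.2.1
    · exact ((hg 0 0).div hd hne).congr fun y _ => (gramMatrix_inv g p y).2.2.2
  refine contDiffOn_const.mul (ContDiffOn.sum fun l _ => (hinv k l).mul ?_)
  exact ((partialD_contDiffOn hO (hg j l) i).add (partialD_contDiffOn hO (hg i l) j)).sub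
    (partialD_contDiffOn hO (hg i j) l)

theorem christoffel_zero_eq (g : Met M) (p : M) (i j : Fin 2) (y : Plane) :
    christoffel g p 0 i j y = (tensorComp g.inner p 1 1 y
        * (partialD i (tensorComp g.inner p j 0) y + partialD j (tensorComp g.inner p i 0) y
          - partialD 0 (tensorComp g.inner p i j) y)
      - tensorComp g.inner p 0 1 y
        * (partialD i (tensorComp g.inner p j 1) y + partialD j (tensorComp g.inner p i 1) y
          - partialD 1 (tensorComp g.inner p i j) y)) / (2 * gramDet g p y) := by
  obtain ⟨h00, h01, -, -⟩ := gramMatrix_inv g p y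
  simp only [christoffel, Fin.sum_univ_two, h00, h01]
  ring

theorem christoffel_one_eq (g : Met M) (p : M) (i j : Fin 2) (y : Plane) :
    christoffel g p 1 i j y = (tensorComp g.inner p 0 0 y
        * (partialD i (tensorComp g.inner p j 1) y + partialD j (tensorComp g.inner p i 1) y
          - partialD 1 (tensorComp g.inner p i j) y)
      - tensorComp g.inner p 0 1 y
        * (partialD i (tensorComp g.inner p j 0) y + partialD j (tensorComp g.inner p i 0) y
          - partialD 0 (tensorComp g.inner p i j) y)) / (2 * gramDet g p y) := by
  obtain ⟨-, -, h10, h11⟩ := gramMatrix_inv g p y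
  simp only [christoffel, Fin.sum_univ_two, h10, h11]
  ring

/-- Lowering the upper index gives the Christoffel symbols of the first kind, which involve no inverse
matrix. -/
theorem sum_gram_mul_christoffel (g : Met M) (p : M) {y : Plane}
    (hy : y ∈ (extChartAt (𝓡 2) p).target) (m i j : Fin 2) :
    tensorComp g.inner p m 0 y * christoffel g p 0 i j y
      + tensorComp g.inner p m 1 y * christoffel g p 1 i j y
      = (1 / 2) * (partialD i (tensorComp g.inner p j m) y + partialD j (tensorComp g.inner p i m) y
        - partialD m (tensorComp g.inner p i j) y) := by
  have hD := (gramDet_pos g p hy).ne'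
  obtain ⟨h00, h01, h10, h11⟩ := gramMatrix_inv g p y
  simp only [christoffel, Fin.sum_univ_two, h00, h01, h10, h11]
  fin_cases m
  · simp only [Fin.zero_eta]
    field_simp
    simp only [gramDet]
    ring
  · simp only [Fin.mk_one, tensorComp_inner_symm]
    field_simp
    simp only [gramDet]
    ring

/-- Gaussian curvature in terms of the 2-jets of `E = g₀₀`, `F = g₀₁`, `G = g₁₁`: the numerator is
`∂₀∂₁F - ½ ∂₀²G - ½ ∂₁²E + g^{lm} (Γ_{l,01} Γ_{m,01} - Γ_{l,00} Γ_{m,11})`, with the Christoffel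
symbols of the first kind written out. -/
theorem gaussCurvature_eq (g : Met M) (p : M) :
    gaussCurvature g p =
      (partialD 0 (partialD 1 (tensorComp g.inner p 0 1)) (coordPt p)
        - partialD 0 (partialD 0 (tensorComp g.inner p 1 1)) (coordPt p) / 2
        - partialD 1 (partialD 1 (tensorComp g.inner p 0 0)) (coordPt p) / 2
        + (let E := tensorComp g.inner p 0 0 (coordPt p)
           let F := tensorComp g.inner p 0 1 (coordPt p)
           let G := tensorComp g.inner p 1 1 (coordPt p)
           let E₀ := partialD 0 (tensorComp g.inner p 0 0) (coordPt p)
           let E₁ := partialD 1 (tensorComp g.inner p 0 0) (coordPt p)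
           let F₀ := partialD 0 (tensorComp g.inner p 0 1) (coordPt p)
           let F₁ := partialD 1 (tensorComp g.inner p 0 1) (coordPt p)
           let G₀ := partialD 0 (tensorComp g.inner p 1 1) (coordPt p)
           let G₁ := partialD 1 (tensorComp g.inner p 1 1) (coordPt p)
           (G * (E₁ ^ 2 / 4 - E₀ / 2 * (F₁ - G₀ / 2))
            - F * (E₁ * G₀ / 2 - E₀ * G₁ / 4 - (F₀ - E₁ / 2) * (F₁ - G₀ / 2))
            + E * (G₀ ^ 2 / 4 - (F₀ - E₁ / 2) * G₁ / 2)) / gramDet g p (coordPt p)))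
      / gramDet g p (coordPt p) := by
  have hO : IsOpen (extChartAt (𝓡 2) p).target := isOpen_extChartAt_target p
  have hp := coordPt_mem_target p
  have hD := (gramDet_pos g p hp).ne'
  have hg : ∀ i j, DifferentiableAt ℝ (tensorComp g.inner p i j) (coordPt p) := fun i j =>
    differentiableAt_of_contDiffOn hO (tensorComp_contDiffOn g.isSmooth p i j) hp
  have hg' : ∀ k i j, DifferentiableAt ℝ (partialD k (tensorComp g.inner p i j)) (coordPt p) :=
    fun k i j => differentiableAt_of_contDiffOn hO
      (partialD_contDiffOn hO (tensorComp_contDiffOn g.isSmooth p i j) k) hp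
  have hΓ : ∀ k i j, DifferentiableAt ℝ (christoffel g p k i j) (coordPt p) := fun k i j =>
    differentiableAt_of_contDiffOn hO (contDiffOn_christoffel g p k i j) hp
  -- Differentiating the lowered Christoffel symbols avoids derivatives of the inverse matrix:
  -- only the two combinations `∑ g₀ₗ ∂Γˡ` enter the curvature.
  have key : ∀ k i j, partialD k (tensorComp g.inner p 0 0) (coordPt p)
        * christoffel g p 0 i j (coordPt p)
      + tensorComp g.inner p 0 0 (coordPt p) * partialD k (christoffel g p 0 i j) (coordPt p)
      + (partialD k (tensorComp g.inner p 0 1) (coordPt p) * christoffel g p 1 i j (coordPt p)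
      + tensorComp g.inner p 0 1 (coordPt p) * partialD k (christoffel g p 1 i j) (coordPt p))
      = (1 / 2) * (partialD k (partialD i (tensorComp g.inner p j 0)) (coordPt p)
        + partialD k (partialD j (tensorComp g.inner p i 0)) (coordPt p)
        - partialD k (partialD 0 (tensorComp g.inner p i j)) (coordPt p)) := by
    intro k i j
    rw [← partialD_mul (hg _ _) (hΓ _ _ _), ← partialD_mul (hg _ _) (hΓ _ _ _),
      ← partialD_add ((hg _ _).fun_mul (hΓ _ _ _)) ((hg _ _).fun_mul (hΓ _ _ _)),
      ← partialD_add (hg' _ _ _) (hg' _ _ _),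
      ← partialD_sub ((hg' _ _ _).fun_add (hg' _ _ _)) (hg' _ _ _),
      ← partialD_const_mul (((hg' _ _ _).fun_add (hg' _ _ _)).fun_sub (hg' _ _ _))]
    exact partialD_congr hO (fun y hy => sum_gram_mul_christoffel g p hy 0 i j) k hp
  have k1 := key 0 1 1
  have k2 := key 1 0 1
  have e : gaussCurvature g p = (tensorComp g.inner p 0 0 (coordPt p) * riemann g p 0 (coordPt p)
      + tensorComp g.inner p 0 1 (coordPt p) * riemann g p 1 (coordPt p))
        / gramDet g p (coordPt p) := by
    rw [gaussCurvature, gramMatrix_det, Fin.sum_univ_two]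
    rfl
  rw [e]
  congr 1
  simp only [riemann, Fin.sum_univ_two]
  simp only [tensorComp_inner_symm] at k1 k2 ⊢
  have hΓ0 := christoffel_zero_eq g p
  have hΓ1 := christoffel_one_eq g p
  generalize partialD 0 (christoffel g p 0 1 1) (coordPt p) = a0 at *
  generalize partialD 0 (christoffel g p 1 1 1) (coordPt p) = a1 at *
  generalize partialD 1 (christoffel g p 0 0 1) (coordPt p) = b0 at *
  generalize partialD 1 (christoffel g p 1 0 1) (coordPt p) = b1 at *
  simp only [hΓ0, hΓ1, tensorComp_inner_symm] at k1 k2 ⊢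
  clear hΓ0 hΓ1 e key hΓ hg hg'
  have hD' : gramDet g p (coordPt p) = tensorComp g.inner p 0 0 (coordPt p) *
    tensorComp g.inner p 1 1 (coordPt p) - tensorComp g.inner p 0 1 (coordPt p) ^ 2 := rfl
  generalize gramDet g p (coordPt p) = D at *
  generalize partialD 0 (partialD 1 (tensorComp g.inner p 0 1)) (coordPt p) = F01 at *
  generalize partialD 0 (partialD 0 (tensorComp g.inner p 1 1)) (coordPt p) = G00 at *
  generalize partialD 1 (partialD 1 (tensorComp g.inner p 0 0)) (coordPt p) = E11 at *
  generalize partialD 1 (partialD 0 (tensorComp g.inner p 0 1)) (coordPt p) = F10 at *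
  generalize partialD 0 (tensorComp g.inner p 0 0) (coordPt p) = E0 at *
  generalize partialD 1 (tensorComp g.inner p 0 0) (coordPt p) = E1 at *
  generalize partialD 0 (tensorComp g.inner p 0 1) (coordPt p) = F0 at *
  generalize partialD 1 (tensorComp g.inner p 0 1) (coordPt p) = F1 at *
  generalize partialD 0 (tensorComp g.inner p 1 1) (coordPt p) = G0 at *
  generalize partialD 1 (tensorComp g.inner p 1 1) (coordPt p) = G1 at *
  generalize tensorComp g.inner p 0 0 (coordPt p) = E at *
  generalize tensorComp g.inner p 0 1 (coordPt p) = F at *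
  generalize tensorComp g.inner p 1 1 (coordPt p) = G at *
  have k := congrArg₂ (· - ·) k1 k2
  rw [← sub_eq_zero] at k ⊢
  refine Eq.trans ?_ k
  field_simp
  subst hD'
  ring

end Curvature

/-! ### Conformal change of the curvature and of the Christoffel symbols -/

section Conformal

set_option linter.unusedSectionVars false

variable {M : Type*} [TopologicalSpace M] [ChartedSpace Plane M] [IsManifold (𝓡 2) ∞ M]

/-- A function read in the chart at `p`. -/
def funComp (f : M → ℝ) (p : M) (y : Plane) : ℝ := f ((extChartAt (𝓡 2) p).symm y)

theorem funComp_coordPt (f : M → ℝ) (p : M) : funComp f p (coordPt p) = f p := by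
  rw [funComp, symm_coordPt]

theorem contDiffOn_funComp {f : M → ℝ} (hf : ContMDiff (𝓡 2) 𝓘(ℝ, ℝ) ∞ f) (p : M) :
    ContDiffOn ℝ ∞ (funComp f p) (extChartAt (𝓡 2) p).target := by
  rw [← contMDiffOn_iff_contDiffOn]
  exact hf.comp_contMDiffOn (contMDiffOn_extChartAt_symm (I := 𝓡 2) (n := ∞) p)

theorem gramDet_partialD (g : Met M) (p : M) (i : Fin 2) {y : Plane}
    (hy : y ∈ (extChartAt (𝓡 2) p).target) :
    partialD i (gramDet g p) y =
      partialD i (tensorComp g.inner p 0 0) y * tensorComp g.inner p 1 1 y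
      + tensorComp g.inner p 0 0 y * partialD i (tensorComp g.inner p 1 1) y
      - 2 * tensorComp g.inner p 0 1 y * partialD i (tensorComp g.inner p 0 1) y := by
  have hg : ∀ i j, DifferentiableAt ℝ (tensorComp g.inner p i j) y := fun i j =>
    differentiableAt_of_contDiffOn (isOpen_extChartAt_target p)
      (tensorComp_contDiffOn g.isSmooth p i j) hy
  have : gramDet g p = fun z => tensorComp g.inner p 0 0 z * tensorComp g.inner p 1 1 z
      - tensorComp g.inner p 0 1 z * tensorComp g.inner p 0 1 z := by
    funext z
    rw [gramDet, sq]
  rw [this, partialD_sub ((hg _ _).fun_mul (hg _ _)) ((hg _ _).fun_mul (hg _ _)),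
    partialD_mul (hg _ _) (hg _ _), partialD_mul (hg _ _) (hg _ _)]
  ring

/-- The derivative of one component `√D (A/D · u/φ + B/D · v/φ)` of the flux whose divergence is the
Laplacian of `log φ`; here `A/D` and `B/D` are entries of the inverse metric and `u`, `v` are the
derivatives of `φ`. -/
theorem partialD_flux {O : Set Plane} (hO : IsOpen O) {y : Plane} (hy : y ∈ O)
    {A B u v D φ : Plane → ℝ} (hA : DifferentiableAt ℝ A y) (hB : DifferentiableAt ℝ B y)
    (hu : DifferentiableAt ℝ u y) (hv : DifferentiableAt ℝ v y)
    (hD : DifferentiableAt ℝ D y) (hφ : DifferentiableAt ℝ φ y)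
    (hD0 : ∀ z ∈ O, 0 < D z) (hφ0 : ∀ z ∈ O, 0 < φ z) (i : Fin 2) {H : Plane → ℝ}
    (hH : ∀ z ∈ O, H z = √(D z) * (A z / D z * (u z / φ z) + B z / D z * (v z / φ z))) :
    (√(D y))⁻¹ * partialD i H y =
      ((partialD i A y * u y + A y * partialD i u y + (partialD i B y * v y + B y * partialD i v y))
          * φ y - (A y * u y + B y * v y) * partialD i φ y) / (φ y ^ 2 * D y)
        - (A y * u y + B y * v y) * partialD i D y / (2 * D y ^ 2 * φ y) := by
  have hDy := (hD0 y hy).ne'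
  have hφy := (hφ0 y hy).ne'
  have hs : ∀ z ∈ O, √(D z) ≠ 0 := fun z hz => (Real.sqrt_pos.2 (hD0 z hz)).ne'
  have h1 : EqOn H (fun z => (A z * u z + B z * v z) / (√(D z) * φ z)) O := by
    intro z hz
    have h2 := Real.sq_sqrt (hD0 z hz).le
    have h3 := hs z hz
    have h4 := (hD0 z hz).ne'
    have h5 := (hφ0 z hz).ne'
    simp only [hH z hz]
    field_simp
    rw [h2]
  have hsd : DifferentiableAt ℝ (fun z => √(D z)) y := hD.sqrt hDy
  rw [partialD_congr hO h1 i hy, partialD_div ((hA.fun_mul hu).fun_add (hB.fun_mul hv))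
    (hsd.fun_mul hφ) (mul_ne_zero (hs y hy) hφy), partialD_add (hA.fun_mul hu) (hB.fun_mul hv),
    partialD_mul hA hu, partialD_mul hB hv, partialD_mul hsd hφ, partialD_sqrt hD hDy]
  have h2 := Real.sq_sqrt (hD0 y hy).le
  have h3 := hs y hy
  generalize √(D y) = s at *
  rw [← h2]
  field_simp
  ring

/-- `Δ_g log f` in terms of the 1-jets of the metric coefficients and the 2-jet of `f`. -/
theorem laplacian_log_eq (g : Met M) {f : M → ℝ} (hf : ContMDiff (𝓡 2) 𝓘(ℝ, ℝ) ∞ f)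
    (hpos : ∀ x, 0 < f x) (p : M) :
    laplacian g (fun x => Real.log (f x)) p =
      (let E := tensorComp g.inner p 0 0 (coordPt p)
       let F := tensorComp g.inner p 0 1 (coordPt p)
       let G := tensorComp g.inner p 1 1 (coordPt p)
       let D := gramDet g p (coordPt p)
       let φ := funComp f p (coordPt p)
       let φ₀ := partialD 0 (funComp f p) (coordPt p)
       let φ₁ := partialD 1 (funComp f p) (coordPt p)
       let d := fun i k l => partialD i (tensorComp g.inner p k l) (coordPt p)
       let d₂ := fun i j => partialD i (partialD j (funComp f p)) (coordPt p);
       -((((d 0 1 1 * φ₀ + G * d₂ 0 0 + (-d 0 0 1 * φ₁ + -F * d₂ 0 1)) * φ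
            - (G * φ₀ + -F * φ₁) * φ₀) / (φ ^ 2 * D)
          - (G * φ₀ + -F * φ₁) * partialD 0 (gramDet g p) (coordPt p) / (2 * D ^ 2 * φ))
        + (((-d 1 0 1 * φ₀ + -F * d₂ 1 0 + (d 1 0 0 * φ₁ + E * d₂ 1 1)) * φ
            - (-F * φ₀ + E * φ₁) * φ₁) / (φ ^ 2 * D)
          - (-F * φ₀ + E * φ₁) * partialD 1 (gramDet g p) (coordPt p) / (2 * D ^ 2 * φ)))) := by
  have hO : IsOpen (extChartAt (𝓡 2) p).target := isOpen_extChartAt_target p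
  have hp := coordPt_mem_target p
  have hφs := contDiffOn_funComp hf p
  have hφ : ∀ y ∈ (extChartAt (𝓡 2) p).target, DifferentiableAt ℝ (funComp f p) y :=
    fun y hy => differentiableAt_of_contDiffOn hO hφs hy
  have hφ' : ∀ i, DifferentiableAt ℝ (partialD i (funComp f p)) (coordPt p) := fun i =>
    differentiableAt_of_contDiffOn hO (partialD_contDiffOn hO hφs i) hp
  have hD : DifferentiableAt ℝ (gramDet g p) (coordPt p) :=
    differentiableAt_of_contDiffOn hO (contDiffOn_gramDet g p) hp
  have hg : ∀ i j, DifferentiableAt ℝ (tensorComp g.inner p i j) (coordPt p) := fun i j =>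
    differentiableAt_of_contDiffOn hO (tensorComp_contDiffOn g.isSmooth p i j) hp
  have hφ0 : ∀ y ∈ (extChartAt (𝓡 2) p).target, 0 < funComp f p y := fun y _ => hpos _
  have hlog : ∀ y ∈ (extChartAt (𝓡 2) p).target, ∀ j,
      partialD j (fun z => Real.log (f ((extChartAt (𝓡 2) p).symm z))) y
        = partialD j (funComp f p) y / funComp f p y :=
    fun y hy j => partialD_log (hφ y hy) (hφ0 y hy).ne' j
  have hneg : ∀ i, partialD i (fun z => -tensorComp g.inner p 0 1 z) (coordPt p)
      = -partialD i (tensorComp g.inner p 0 1) (coordPt p) := by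
    intro i
    simp only [partialD, fderiv_fun_neg, neg_apply]
  have h0 := partialD_flux hO hp (hg 1 1) (hg 0 1).fun_neg (hφ' 0) (hφ' 1) hD (hφ _ hp)
    (fun y hy => gramDet_pos g p hy) hφ0 0
    (H := fun y => √(gramMatrix g p y).det * ∑ j, (gramMatrix g p y)⁻¹ 0 j *
      partialD j (fun z => Real.log (f ((extChartAt (𝓡 2) p).symm z))) y) (by
    intro y hy
    obtain ⟨h00, h01, h10, h11⟩ := gramMatrix_inv g p y
    simp only [Fin.sum_univ_two, gramMatrix_det, hlog y hy, h00, h01])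
  have h1 := partialD_flux hO hp (hg 0 1).fun_neg (hg 0 0) (hφ' 0) (hφ' 1) hD (hφ _ hp)
    (fun y hy => gramDet_pos g p hy) hφ0 1
    (H := fun y => √(gramMatrix g p y).det * ∑ j, (gramMatrix g p y)⁻¹ 1 j *
      partialD j (fun z => Real.log (f ((extChartAt (𝓡 2) p).symm z))) y) (by
    intro y hy
    obtain ⟨h00, h01, h10, h11⟩ := gramMatrix_inv g p y
    simp only [Fin.sum_univ_two, gramMatrix_det, hlog y hy, h10, h11])
  rw [hneg] at h0 h1
  rw [laplacian, Fin.sum_univ_two, neg_mul, mul_add, gramMatrix_det g p (coordPt p), h0, h1]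

theorem partialD_conformal (g : Met M) {f : M → ℝ} (hf : ContMDiff (𝓡 2) 𝓘(ℝ, ℝ) ∞ f)
    (hpos : ∀ x, 0 < f x) (p : M) (k i j : Fin 2) {y : Plane}
    (hy : y ∈ (extChartAt (𝓡 2) p).target) :
    partialD k (tensorComp (g.conformal f hf hpos).inner p i j) y
      = partialD k (funComp f p) y * tensorComp g.inner p i j y
        + funComp f p y * partialD k (tensorComp g.inner p i j) y := by
  have hO : IsOpen (extChartAt (𝓡 2) p).target := isOpen_extChartAt_target p
  exact partialD_mul (differentiableAt_of_contDiffOn hO (contDiffOn_funComp hf p) hy)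
    (differentiableAt_of_contDiffOn hO (tensorComp_contDiffOn g.isSmooth p i j) hy) k

theorem partialD_partialD_conformal (g : Met M) {f : M → ℝ} (hf : ContMDiff (𝓡 2) 𝓘(ℝ, ℝ) ∞ f)
    (hpos : ∀ x, 0 < f x) (p : M) (l k i j : Fin 2) {y : Plane}
    (hy : y ∈ (extChartAt (𝓡 2) p).target) :
    partialD l (partialD k (tensorComp (g.conformal f hf hpos).inner p i j)) y
      = (partialD l (partialD k (funComp f p)) y * tensorComp g.inner p i j y
        + partialD k (funComp f p) y * partialD l (tensorComp g.inner p i j) y)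
        + (partialD l (funComp f p) y * partialD k (tensorComp g.inner p i j) y
        + funComp f p y * partialD l (partialD k (tensorComp g.inner p i j)) y) := by
  have hO : IsOpen (extChartAt (𝓡 2) p).target := isOpen_extChartAt_target p
  have h1 := contDiffOn_funComp hf p
  have h2 := tensorComp_contDiffOn g.isSmooth p i j
  have d1 := differentiableAt_of_contDiffOn hO h1 hy
  have d2 := differentiableAt_of_contDiffOn hO h2 hy
  have d3 := differentiableAt_of_contDiffOn hO (partialD_contDiffOn hO h1 k) hy
  have d4 := differentiableAt_of_contDiffOn hO (partialD_contDiffOn hO h2 k) hy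
  rw [partialD_congr hO (fun z hz => partialD_conformal g hf hpos p k i j hz) l hy,
    partialD_add (d3.fun_mul d2) (d1.fun_mul d4), partialD_mul d3 d2, partialD_mul d1 d4]

theorem gramDet_conformal (g : Met M) {f : M → ℝ} (hf : ContMDiff (𝓡 2) 𝓘(ℝ, ℝ) ∞ f)
    (hpos : ∀ x, 0 < f x) (p : M) (y : Plane) :
    gramDet (g.conformal f hf hpos) p y = funComp f p y ^ 2 * gramDet g p y := by
  change (funComp f p y * tensorComp g.inner p 0 0 y) * (funComp f p y * tensorComp g.inner p 1 1 y)
    - (funComp f p y * tensorComp g.inner p 0 1 y) ^ 2 = _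
  rw [gramDet]
  ring

theorem tensorComp_conformal (g : Met M) {f : M → ℝ} (hf : ContMDiff (𝓡 2) 𝓘(ℝ, ℝ) ∞ f)
    (hpos : ∀ x, 0 < f x) (p : M) (i j : Fin 2) (y : Plane) :
    tensorComp (g.conformal f hf hpos).inner p i j y
      = funComp f p y * tensorComp g.inner p i j y := rfl

/-- The curvature of a conformal metric: `f K_{fg} = K_g + ½ Δ_g log f`. -/
theorem gaussCurvature_conformal (g : Met M) {f : M → ℝ} (hf : ContMDiff (𝓡 2) 𝓘(ℝ, ℝ) ∞ f)
    (hpos : ∀ x, 0 < f x) (p : M) :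
    f p * gaussCurvature (g.conformal f hf hpos) p
      = gaussCurvature g p + (1 / 2) * laplacian g (fun x => Real.log (f x)) p := by
  have hO : IsOpen (extChartAt (𝓡 2) p).target := isOpen_extChartAt_target p
  have hp := coordPt_mem_target p
  have hD := (gramDet_pos g p hp).ne'
  have hφ : funComp f p (coordPt p) ≠ 0 := (hpos _).ne'
  have hc : partialD 1 (partialD 0 (funComp f p)) (coordPt p)
      = partialD 0 (partialD 1 (funComp f p)) (coordPt p) :=
    partialD_comm (contDiffAt_infty.1 ((contDiffOn_funComp hf p).contDiffAt
      (target_mem_nhds_coordPt p)) 2) 1 0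
  rw [laplacian_log_eq g hf hpos, gaussCurvature_eq, gaussCurvature_eq, ← funComp_coordPt f p]
  simp only [partialD_partialD_conformal g hf hpos p _ _ _ _ hp,
    partialD_conformal g hf hpos p _ _ _ hp, gramDet_conformal, tensorComp_conformal,
    gramDet_partialD g p _ hp, hc]
  clear hc
  have hD' : gramDet g p (coordPt p) = tensorComp g.inner p 0 0 (coordPt p) *
    tensorComp g.inner p 1 1 (coordPt p) - tensorComp g.inner p 0 1 (coordPt p) ^ 2 := rfl
  generalize gramDet g p (coordPt p) = D at *
  generalize partialD 0 (partialD 1 (tensorComp g.inner p 0 1)) (coordPt p) = F01 at *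
  generalize partialD 0 (partialD 0 (tensorComp g.inner p 1 1)) (coordPt p) = G00 at *
  generalize partialD 1 (partialD 1 (tensorComp g.inner p 0 0)) (coordPt p) = E11 at *
  generalize partialD 0 (tensorComp g.inner p 0 0) (coordPt p) = E0 at *
  generalize partialD 1 (tensorComp g.inner p 0 0) (coordPt p) = E1 at *
  generalize partialD 0 (tensorComp g.inner p 0 1) (coordPt p) = F0 at *
  generalize partialD 1 (tensorComp g.inner p 0 1) (coordPt p) = F1 at *
  generalize partialD 0 (tensorComp g.inner p 1 1) (coordPt p) = G0 at *
  generalize partialD 1 (tensorComp g.inner p 1 1) (coordPt p) = G1 at *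
  generalize tensorComp g.inner p 0 0 (coordPt p) = E at *
  generalize tensorComp g.inner p 0 1 (coordPt p) = F at *
  generalize tensorComp g.inner p 1 1 (coordPt p) = G at *
  generalize partialD 0 (partialD 0 (funComp f p)) (coordPt p) = f00 at *
  generalize partialD 0 (partialD 1 (funComp f p)) (coordPt p) = f01 at *
  generalize partialD 1 (partialD 1 (funComp f p)) (coordPt p) = f11 at *
  generalize partialD 0 (funComp f p) (coordPt p) = f0 at *
  generalize partialD 1 (funComp f p) (coordPt p) = f1 at *
  generalize funComp f p (coordPt p) = φ at *
  field_simp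
  subst hD'
  ring

/-- `Γ'^k_ij = Γ^k_ij + (δ^k_j ∂_i f + δ^k_i ∂_j f - g_ij g^{kl} ∂_l f) / (2f)` for the metric `f g`. -/
theorem christoffel_conformal (g : Met M) {f : M → ℝ} (hf : ContMDiff (𝓡 2) 𝓘(ℝ, ℝ) ∞ f)
    (hpos : ∀ x, 0 < f x) (p : M) (i j : Fin 2) {y : Plane}
    (hy : y ∈ (extChartAt (𝓡 2) p).target) (k : Fin 2) :
    christoffel (g.conformal f hf hpos) p k i j y = christoffel g p k i j y
      + ((if k = j then 1 else 0) * partialD i (funComp f p) y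
        + (if k = i then 1 else 0) * partialD j (funComp f p) y
        - tensorComp g.inner p i j y * ((gramMatrix g p y)⁻¹ k 0 * partialD 0 (funComp f p) y
          + (gramMatrix g p y)⁻¹ k 1 * partialD 1 (funComp f p) y)) / (2 * funComp f p y) := by
  have hD := (gramDet_pos g p hy).ne'
  have hφ : funComp f p y ≠ 0 := (hpos _).ne'
  obtain ⟨h00, h01, h10, h11⟩ := gramMatrix_inv g p y
  fin_cases k
  · simp only [Fin.zero_eta, christoffel_zero_eq, gramDet_conformal, tensorComp_conformal, h00, h01,
      partialD_conformal g hf hpos p _ _ _ hy]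
    fin_cases i <;> fin_cases j <;>
    · simp only [Fin.zero_eta, Fin.mk_one, tensorComp_inner_symm, if_true, if_false, zero_ne_one]
      field_simp
      simp only [gramDet]
      ring
  · simp only [Fin.mk_one, christoffel_one_eq, gramDet_conformal, tensorComp_conformal, h10, h11,
      partialD_conformal g hf hpos p _ _ _ hy]
    fin_cases i <;> fin_cases j <;>
    · simp only [Fin.zero_eta, Fin.mk_one, tensorComp_inner_symm, if_true, if_false, one_ne_zero]
      field_simp
      simp only [gramDet]
      ring

end Conformal

/-! ### Conformal invariance of the Cauchy-Riemann operator -/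

theorem plane_bilin_complex (B : Plane →L[ℝ] Plane →L[ℝ] ℂ) (v w : Plane) :
    B v w = v 0 * w 0 * B (stdVec 0) (stdVec 0) + v 0 * w 1 * B (stdVec 0) (stdVec 1)
      + v 1 * w 0 * B (stdVec 1) (stdVec 0) + v 1 * w 1 * B (stdVec 1) (stdVec 1) := by
  conv_lhs => rw [plane_decomp v, plane_decomp w]
  simp only [map_add, map_smul, add_apply, smul_apply, Complex.real_smul]
  ring

theorem IsCompatibleStructure.exists_eq_add {G η : Plane →L[ℝ] Plane →L[ℝ] ℝ}
    {J : Plane →L[ℝ] Plane} (halt : ∀ v, η v v = 0) (hJ : IsCompatibleStructure G η J)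
    {v : Plane} (hv : v ≠ 0) (w : Plane) : ∃ a b : ℝ, w = a • v + b • J v := by
  have hli : LinearIndependent ℝ ![v, J v] := by
    rw [LinearIndependent.pair_iff]
    intro s t hst
    have e1 := congrArg (fun z => η v z) hst
    simp only [map_add, map_smul, halt, smul_eq_mul, map_zero, mul_zero, zero_add] at e1
    have ht : t = 0 := (mul_eq_zero.1 e1).resolve_right (hJ.2.2 v hv).ne'
    refine ⟨?_, ht⟩
    rw [ht, zero_smul, add_zero] at hst
    exact (smul_eq_zero.1 hst).resolve_right hv
  have hw : w ∈ Submodule.span ℝ (Set.range ![v, J v]) :=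
    hli.span_eq_top_of_card_eq_finrank (by simp [Plane]) ▸ Submodule.mem_top
  simp only [Matrix.range_cons, Matrix.range_empty, Set.union_empty,
    Set.singleton_union, Submodule.mem_span_pair] at hw
  obtain ⟨a, b, h⟩ := hw
  exact ⟨a, b, h.symm⟩

/-- For fixed `v` and `z`, the form `x ↦ G(v,x) + i G(Jv,x)` and the form `x ↦ q(x,z)` are both complex
linear on the complex line `(V, J)`, hence proportional. -/
theorem IsCompatibleStructure.hermitian_exchange {G η : Plane →L[ℝ] Plane →L[ℝ] ℝ}
    {J : Plane →L[ℝ] Plane} (halt : ∀ v, η v v = 0)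
    (hJ : IsCompatibleStructure G η J) {q : Plane →L[ℝ] Plane →L[ℝ] ℂ}
    (hqJ : ∀ v w, q (J v) w = Complex.I * q v w) (v x y z : Plane) :
    ((G v x : ℂ) + Complex.I * G (J v) x) * q y z
      = ((G v y : ℂ) + Complex.I * G (J v) y) * q x z := by
  rcases eq_or_ne x 0 with rfl | hx
  · simp
  obtain ⟨a, b, rfl⟩ := hJ.exists_eq_add halt hx y
  have h1 : G v (J x) = -G (J v) x := by
    rw [← hJ.2.1 v (J x), hJ.1, map_neg]
  simp only [map_add, map_smul, add_apply, smul_apply, smul_eq_mul, Complex.real_smul, hqJ, h1,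
    hJ.2.1]
  push_cast
  linear_combination ((b : ℂ) * G (J v) x * q x z) * Complex.I_sq

/-- The terms by which `∇σ` changes under a conformal change of the metric cancel in `∂̄σ`. -/
theorem IsCompatibleStructure.dbar_correction {G η : Plane →L[ℝ] Plane →L[ℝ] ℝ}
    {J : Plane →L[ℝ] Plane} (halt : ∀ v, η v v = 0)
    (hJ : IsCompatibleStructure G η J) {q : Plane →L[ℝ] Plane →L[ℝ] ℂ}
    (hq : ∀ v w, q v w = q w v)
    (hqJ : ∀ v w, q (J v) w = Complex.I * q v w) (W v x z : Plane) :
    (2 * G v W * q x z + G x W * q v z + G z W * q x v - G v x * q W z - G v z * q x W)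
      + Complex.I * (2 * G (J v) W * q x z + G x W * q (J v) z + G z W * q x (J v)
        - G (J v) x * q W z - G (J v) z * q x W) = 0 := by
  have h1 := hJ.hermitian_exchange halt hqJ v x W z
  have h2 := hJ.hermitian_exchange halt hqJ v z W x
  rw [hq x (J v), hqJ, hqJ, hq v x] at *
  rw [hq W x, hq z x] at h2
  linear_combination -h1 - h2 + (G x W * q v z + G z W * q x v) * Complex.I_sq

section Conformal

set_option linter.unusedSectionVars false

variable {M : Type*} [TopologicalSpace M] [ChartedSpace Plane M] [IsManifold (𝓡 2) ∞ M]
  {ρ : AreaForm M}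

/-- The change of `∇σ` under a conformal change of the metric; `W` is the `g`-gradient of `f` at `p`. -/
theorem covDeriv_conformal (g : Met M) {f : M → ℝ} (hf : ContMDiff (𝓡 2) 𝓘(ℝ, ℝ) ∞ f)
    (hpos : ∀ x, 0 < f x) (σ : BilinField M ℂ) (p : M) :
    ∃ W : TangentSpace (𝓡 2) p, ∀ v x z : TangentSpace (𝓡 2) p,
      covDeriv (g.conformal f hf hpos) σ p v x z = covDeriv g σ p v x z
        - 1 / (2 * f p) * (2 * g.inner p v W * σ p x z + g.inner p x W * σ p v z
          + g.inner p z W * σ p x v - g.inner p v x * σ p W z - g.inner p v z * σ p x W) := by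
  have hp := coordPt_mem_target p
  have hφ0 : (f p : ℂ) ≠ 0 := Complex.ofReal_ne_zero.2 (hpos p).ne'
  obtain ⟨φ₀, hφ₀⟩ : ∃ a, partialD 0 (funComp f p) (coordPt p) = a := ⟨_, rfl⟩
  obtain ⟨φ₁, hφ₁⟩ : ∃ a, partialD 1 (funComp f p) (coordPt p) = a := ⟨_, rfl⟩
  obtain ⟨W₀, hW₀⟩ : ∃ a, (gramMatrix g p (coordPt p))⁻¹ 0 0 * φ₀
    + (gramMatrix g p (coordPt p))⁻¹ 0 1 * φ₁ = a := ⟨_, rfl⟩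
  obtain ⟨W₁, hW₁⟩ : ∃ a, (gramMatrix g p (coordPt p))⁻¹ 1 0 * φ₀
    + (gramMatrix g p (coordPt p))⁻¹ 1 1 * φ₁ = a := ⟨_, rfl⟩
  have hD := (gramDet_pos g p hp).ne'
  -- Lowering the index of the gradient gives back the differential of `f`.
  have e0 : φ₀ = tensorComp g.inner p 0 0 (coordPt p) * W₀
      + tensorComp g.inner p 0 1 (coordPt p) * W₁ := by
    obtain ⟨h00, h01, h10, h11⟩ := gramMatrix_inv g p (coordPt p)
    rw [← hW₀, ← hW₁, h00, h01, h10, h11]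
    field_simp
    rw [gramDet]
    ring
  have e1 : φ₁ = tensorComp g.inner p 0 1 (coordPt p) * W₀
      + tensorComp g.inner p 1 1 (coordPt p) * W₁ := by
    obtain ⟨h00, h01, h10, h11⟩ := gramMatrix_inv g p (coordPt p)
    rw [← hW₀, ← hW₁, h00, h01, h10, h11]
    field_simp
    rw [gramDet]
    ring
  have ht : ∀ v : Plane, tangentCoord p v = v := tangentCoord_eq p
  have hg : ∀ v w : Plane, g.inner p v w = v 0 * w 0 * tensorComp g.inner p 0 0 (coordPt p)
      + v 0 * w 1 * tensorComp g.inner p 0 1 (coordPt p)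
      + v 1 * w 0 * tensorComp g.inner p 0 1 (coordPt p)
      + v 1 * w 1 * tensorComp g.inner p 1 1 (coordPt p) := by
    intro v w
    conv_rhs => enter [1, 2]; rw [← tensorComp_inner_symm]
    simp only [tensorComp_coordPt]
    exact plane_bilin (g.inner p) v w
  have hs : ∀ v w : Plane, σ p v w = v 0 * w 0 * tensorComp σ p 0 0 (coordPt p)
      + v 0 * w 1 * tensorComp σ p 0 1 (coordPt p)
      + v 1 * w 0 * tensorComp σ p 1 0 (coordPt p)
      + v 1 * w 1 * tensorComp σ p 1 1 (coordPt p) := by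
    intro v w
    simp only [tensorComp_coordPt]
    exact plane_bilin_complex (σ p) v w
  refine ⟨(!₂[W₀, W₁] : Plane), fun (v : Plane) (x : Plane) (z : Plane) => ?_⟩
  have hΓ := fun i j => christoffel_conformal g hf hpos p i j hp 0
  have hΓ' := fun i j => christoffel_conformal g hf hpos p i j hp 1
  rw [hg v, hg x, hg z, hg v x, hg v z, hs x z, hs v z, hs x v, hs _ z, hs x]
  simp only [covDeriv, covDerivComp, Fin.sum_univ_two, ht, hΓ, hΓ', hφ₀, hφ₁,
    hW₀, hW₁, if_true, if_false, zero_ne_one, one_ne_zero, funComp_coordPt, tensorComp_inner_symm]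
  rw [e0, e1]
  clear hs hg hΓ hΓ' hW₀ hW₁ hφ₀ hφ₁ e0 e1
  generalize tensorComp g.inner p 0 0 (coordPt p) = E
  generalize tensorComp g.inner p 0 1 (coordPt p) = F
  generalize tensorComp g.inner p 1 1 (coordPt p) = G
  simp only [Matrix.cons_val_zero, Matrix.cons_val_one]
  push_cast
  field_simp
  ring

/-- `∂̄σ` depends only on the conformal class of the metric. -/
theorem dbar_conformal (g : Met M) {f : M → ℝ} (hf : ContMDiff (𝓡 2) 𝓘(ℝ, ℝ) ∞ f)
    (hpos : ∀ x, 0 < f x) (σ : QuadDiff ρ g) (σ' : QuadDiff ρ (g.conformal f hf hpos))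
    (h : σ'.form = σ.form) (p : M) (v x z : TangentSpace (𝓡 2) p) :
    dbar (g.conformal f hf hpos) σ' p v x z = dbar g σ p v x z := by
  obtain ⟨W, hW⟩ := covDeriv_conformal g hf hpos σ.form p
  have hc := IsCompatibleStructure.dbar_correction (ρ.alt p) (complexStructure_spec ρ g p)
    (σ.symm p) (σ.complex_linear p) W v x z
  rw [dbar, dbar, h, complexStructure_conformal, hW, hW]
  linear_combination (-(1 / 2) * (1 / (2 * (f p : ℂ)))) * hc

end Conformal

/-! ### The map on pairs and on moduli spaces -/

section Bijection

set_option linter.unusedSectionVars false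

variable {M : Type*} [TopologicalSpace M] [ChartedSpace Plane M] [IsManifold (𝓡 2) ∞ M]
  {ρ : AreaForm M}

theorem ConformalProfile.dbar_rescale (a : ConformalProfile) (q : MetricPair ρ) (p : M)
    (v x z : TangentSpace (𝓡 2) p) :
    dbar (a.rescale q).metric (a.rescale q).diff p v x z = dbar q.metric q.diff p v x z :=
  dbar_conformal q.metric (a.contMDiff_factor q) (a.factor_pos q) q.diff (a.rescale q).diff rfl p v x z

/-- Two rescalings are inverse to each other when the product of the conformal factors is one; the
second factor is taken at the new norm `r / a(r²)`. -/
theorem ConformalProfile.rescale_rescale {a b : ConformalProfile}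
    (h : ∀ r, 0 ≤ r → r < 1 → b.toFun ((r / a.toFun (r ^ 2)) ^ 2) * a.toFun (r ^ 2) = 1)
    (q : MetricPair ρ) : b.rescale (a.rescale q) = q := by
  refine MetricPair.ext_form (fun x v w => ?_) fun x v w => rfl
  change b.factor (a.rescale q) x * (a.factor q x * q.metric.inner x v w) = _
  have := h _ (quadNorm_nonneg q.metric q.diff x) (q.norm_lt x)
  rw [factor, a.quadNorm_rescale, factor, ← mul_assoc, this, one_mul]

/-- The profile `1 + √(1 - t)` of the map `R`. -/
def forwardProfile : ConformalProfile where
  toFun t := 1 + √(1 - t)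
  contDiffOn := contDiffOn_const.add <| (contDiffOn_const.sub contDiffOn_id).sqrt
    fun t ht => (sub_pos.2 ht).ne'
  lt r _ h1 := by linarith [Real.sqrt_nonneg (1 - r ^ 2)]

/-- The profile `(1 + t) / 2` of the inverse of `R`. -/
def backwardProfile : ConformalProfile where
  toFun t := (1 + t) / 2
  contDiffOn := (contDiffOn_const.add contDiffOn_id).div_const 2
  lt r _ h1 := by nlinarith [mul_pos (sub_pos.2 h1) (sub_pos.2 h1)]

/-- The new norm `r / f`, `f = 1 + √(1 - r²)`, satisfies `(r / f)² = 2 / f - 1`, because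
`f² = 2 f - r²`. -/
theorem forward_norm_sq {r : ℝ} (h0 : 0 ≤ r) (h1 : r < 1) :
    (r / (1 + √(1 - r ^ 2))) ^ 2 = 2 / (1 + √(1 - r ^ 2)) - 1 := by
  have hs := Real.sq_sqrt (show 0 ≤ 1 - r ^ 2 by nlinarith)
  have h : 1 + √(1 - r ^ 2) ≠ 0 := by positivity
  field_simp
  linear_combination hs

theorem backward_forward (q : MetricPair ρ) :
    backwardProfile.rescale (forwardProfile.rescale q) = q := by
  refine ConformalProfile.rescale_rescale (fun r h0 h1 => ?_) q
  change (1 + (r / (1 + √(1 - r ^ 2))) ^ 2) / 2 * (1 + √(1 - r ^ 2)) = 1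
  have h : 1 + √(1 - r ^ 2) ≠ 0 := by positivity
  rw [forward_norm_sq h0 h1]
  field_simp
  ring

theorem forward_backward (q : MetricPair ρ) :
    forwardProfile.rescale (backwardProfile.rescale q) = q := by
  refine ConformalProfile.rescale_rescale (fun r h0 h1 => ?_) q
  change (1 + √(1 - (r / ((1 + r ^ 2) / 2)) ^ 2)) * ((1 + r ^ 2) / 2) = 1
  have h : 1 + r ^ 2 ≠ 0 := by positivity
  have h2 : 0 ≤ (1 - r ^ 2) / (1 + r ^ 2) := div_nonneg (by nlinarith) (by positivity)
  have e : 1 - (r / ((1 + r ^ 2) / 2)) ^ 2 = ((1 - r ^ 2) / (1 + r ^ 2)) ^ 2 := by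
    field_simp
    ring
  rw [e, Real.sqrt_sq h2]
  field_simp
  ring

/-- With `f = 1 + √(1 - |σ|_g²)` and `h = f g`, the equation for `g` reads `f K_h = c`, and the one for
`h` reads `K_h = (c / 2) (1 + |σ|_h²) = c / f`. -/
theorem forward_mem_solutions_iff (c : ℝ) (q : MetricPair ρ) :
    forwardProfile.rescale q ∈ solutions ρ c ↔ q ∈ solutionsD ρ c := by
  refine and_congr ?_ (forall_congr' fun x => ?_)
  · simp only [ConformalProfile.dbar_rescale]
  · have hK : forwardProfile.factor q x * gaussCurvature (forwardProfile.rescale q).metric x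
        = gaussCurvature q.metric x + (1 / 2) * laplacian q.metric
          (fun y => Real.log (forwardProfile.factor q y)) x :=
      gaussCurvature_conformal q.metric (forwardProfile.contMDiff_factor q)
        (forwardProfile.factor_pos q) x
    have hf := forwardProfile.factor_pos q x
    have hn : (quadNorm q.metric q.diff x / forwardProfile.factor q x) ^ 2
        = 2 / forwardProfile.factor q x - 1 :=
      forward_norm_sq (quadNorm_nonneg _ _ _) (q.norm_lt x)
    change gaussCurvature (forwardProfile.rescale q).metric x - _ = _ ↔
      gaussCurvature q.metric x
        + (1 / 2) * laplacian q.metric (fun y => Real.log (forwardProfile.factor q y)) x = c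
    rw [← hK, forwardProfile.quadNorm_rescale, hn]
    generalize gaussCurvature (forwardProfile.rescale q).metric x = K
    field_simp
    constructor <;> intro h <;> linarith

/-- The map on moduli spaces induced by a conformal rescaling. -/
def ConformalProfile.moduliMap (a : ConformalProfile) {S T : Set (MetricPair ρ)}
    (h : ∀ q ∈ S, a.rescale q ∈ T) : ModuliSpace S → ModuliSpace T :=
  Quotient.map (fun q => ⟨a.rescale q, h q q.2⟩) fun _ _ ⟨φ, hφ, hφ'⟩ => ⟨φ, hφ, hφ'.rescale a⟩

theorem ConformalProfile.continuous_moduliMap (a : ConformalProfile) {S T : Set (MetricPair ρ)}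
    (h : ∀ q ∈ S, a.rescale q ∈ T) : Continuous (a.moduliMap h) :=
  Continuous.quotient_map' ((a.continuous_rescale.comp continuous_subtype_val).subtype_mk _) _

theorem ConformalProfile.isSmoothModuliFamily (a : ConformalProfile) {S T : Set (MetricPair ρ)}
    (h : ∀ q ∈ S, a.rescale q ∈ T) {n : ℕ} {γ : EuclideanSpace ℝ (Fin n) → ModuliSpace S}
    (hγ : IsSmoothModuliFamily γ) : IsSmoothModuliFamily (fun t => a.moduliMap h (γ t)) := by
  intro t
  obtain ⟨U, hU, ht, γ', hγ', e⟩ := hγ t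
  exact ⟨U, hU, ht, fun s => ⟨a.rescale (γ' s), h _ (γ' s).2⟩, hγ'.rescale a,
    fun s hs => congrArg (a.moduliMap h) (e s hs)⟩

theorem ConformalProfile.moduliMap_moduliMap {a b : ConformalProfile} {S T : Set (MetricPair ρ)}
    (h : ∀ q ∈ S, a.rescale q ∈ T) (h' : ∀ q ∈ T, b.rescale q ∈ S)
    (hab : ∀ q ∈ S, b.rescale (a.rescale q) = q) (x : ModuliSpace S) :
    b.moduliMap h' (a.moduliMap h x) = x := by
  induction x using Quotient.inductionOn with
  | h q => exact congrArg (ModuliSpace.mk (S := S)) (Subtype.ext (hab q q.2))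

end Bijection

end

theorem mainTheorem11 {M : Type*} [TopologicalSpace M] [ChartedSpace Plane M]
    [IsManifold (𝓡 2) ∞ M] [CompactSpace M] [T2Space M] [ConnectedSpace M]
    (ρ : AreaForm M) (c : ℝ) :
    ∃ R : MetricPair ρ → MetricPair ρ,
      (∀ q x, (R q).metric.inner x = conformalFactor q x • q.metric.inner x ∧
        (R q).diff.form x = q.diff.form x) ∧
      ∃ hR : ∀ q ∈ solutionsD ρ c, R q ∈ solutions ρ c,
        ∃ Φ : ModuliSpace (solutionsD ρ c) ≃ₜ ModuliSpace (solutions ρ c),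
          (∀ q : solutionsD ρ c, Φ (ModuliSpace.mk q) = ModuliSpace.mk ⟨R q, hR q q.2⟩) ∧
          ∀ (n : ℕ) (γ : EuclideanSpace ℝ (Fin n) → ModuliSpace (solutionsD ρ c)),
            IsSmoothModuliFamily γ ↔ IsSmoothModuliFamily (fun t => Φ (γ t)) := by
  have hR : ∀ q ∈ solutionsD ρ c, forwardProfile.rescale q ∈ solutions ρ c :=
    fun q hq => (forward_mem_solutions_iff c q).2 hq
  have hS : ∀ q ∈ solutions ρ c, backwardProfile.rescale q ∈ solutionsD ρ c := fun q hq =>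
    (forward_mem_solutions_iff c _).1 ((forward_backward q).symm ▸ hq)
  have hSR : ∀ x, backwardProfile.moduliMap hS (forwardProfile.moduliMap hR x) = x :=
    ConformalProfile.moduliMap_moduliMap hR hS fun q _ => backward_forward q
  have hRS : ∀ x, forwardProfile.moduliMap hR (backwardProfile.moduliMap hS x) = x :=
    ConformalProfile.moduliMap_moduliMap hS hR fun q _ => forward_backward q
  let Φ : ModuliSpace (solutionsD ρ c) ≃ₜ ModuliSpace (solutions ρ c) :=
    { toFun := forwardProfile.moduliMap hR
      invFun := backwardProfile.moduliMap hS
      left_inv := hSR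
      right_inv := hRS
      continuous_toFun := forwardProfile.continuous_moduliMap hR
      continuous_invFun := backwardProfile.continuous_moduliMap hS }
  refine ⟨forwardProfile.rescale, fun q x => ⟨rfl, rfl⟩, hR, Φ, fun q => rfl, fun n γ => ?_⟩
  refine ⟨forwardProfile.isSmoothModuliFamily hR, fun h => ?_⟩
  have h' := backwardProfile.isSmoothModuliFamily hS h
  have e : (fun t => backwardProfile.moduliMap hS (Φ (γ t))) = γ := funext fun t => hSR (γ t)
  rwa [e] at h'
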